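/- Let $k$ be an algebraically closed field and let $\Lambda$ be a finite dimensional $k$-algebra. Write $\operatorname{mod}\Lambda$ for the category of finitely generated right $\Lambda$-modules and $\operatorname{pd}_\Lambda M$ for the projective dimension of $M$, and set $\mathcal{P}^1(\Lambda)=\{M\in\operatorname{mod}\Lambda \mid \operatorname{pd}_\Lambda M\le 1\}$. A torsion pair in $\operatorname{mod}\Lambda$ is a pair $(\mathcal{T},\mathcal{F})$ of full subcategories such that (1) $\operatorname{Hom}_\Lambda(M,N)=0$ for all $M\in\mathcal{T}$, $N\in\mathcal{F}$; (2) if $M\in\operatorname{mod}\Lambda$ and $\operatorname{Hom}_\Lambda(M,N)=0$ for all $N\in\mathcal{F}$, then $M\in\mathcal{T}$; (3) if $N\in\operatorname{mod}\Lambda$ and $\operatorname{Hom}_\Lambda(M,N)=0$ for all $M\in\mathcal{T}$, then $N\in\mathcal{F}$. It is hereditary if $\mathcal{T}$ is closed under submodules. Call $\Lambda$ an Auslander algebra if there is a finite dimensional $k$-algebra $A$ of finite representation type, with a complete set $M_1,\dots,M_n$ of representatives of the isomorphism classes of indecomposable modules in $\operatorname{mod}A$, such that $\Lambda\cong\operatorname{End}_A\big(\bigoplus_{i=1}^n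 M_i^{m_i}\big)$ as $k$-algebras for some integers $m_1,\dots,m_n\ge 1$ (equivalently, $\Lambda$ is Morita equivalent to $\operatorname{End}_A\big(\bigoplus_{i=1}^n M_i\big)$). Theorem. $\Lambda$ is an Auslander algebra if and only if both of the following hold: (a) there exists a hereditary torsion pair $(\mathcal{T},\mathcal{F})$ in $\operatorname{mod}\Lambda$ such that $\mathcal{P}^1(\Lambda)=\mathcal{F}$; (b) every indecomposable injective module $I\in\operatorname{mod}\Lambda$ satisfies $\operatorname{pd}_\Lambda I\neq 1$. -/

import Mathlib

open CategoryTheory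

universe v u

/-- `(𝒯, ℱ)` is a torsion pair in the category `mod R` of finitely generated `R`-modules. The two
full subcategories of `mod R` are given as properties of `R`-modules that imply finite
generation. -/
structure IsTorsionPair (R : Type u) [Ring R] (𝒯 ℱ : ObjectProperty (ModuleCat.{u} R)) :
    Prop where
  torsion_le : 𝒯 ≤ ModuleCat.isFG R
  torsionFree_le : ℱ ≤ ModuleCat.isFG R
  hom_eq_zero : ∀ M N : ModuleCat.{u} R, 𝒯 M → ℱ N → ∀ f : M ⟶ N, f = 0
  torsion_of_hom_eq_zero : ∀ M : ModuleCat.{u} R, ModuleCat.isFG R M →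
    (∀ N : ModuleCat.{u} R, ℱ N → ∀ f : M ⟶ N, f = 0) → 𝒯 M
  torsionFree_of_hom_eq_zero : ∀ N : ModuleCat.{u} R, ModuleCat.isFG R N →
    (∀ M : ModuleCat.{u} R, 𝒯 M → ∀ f : M ⟶ N, f = 0) → ℱ N

/-- A torsion pair is hereditary if its torsion class is closed under submodules. -/
structure IsHereditaryTorsionPair (R : Type u) [Ring R]
    (𝒯 ℱ : ObjectProperty (ModuleCat.{u} R)) : Prop extends IsTorsionPair R 𝒯 ℱ where
  closedUnderSubmodules : 𝒯.IsClosedUnderSubobjects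

/-- The finitely generated `R`-modules of projective dimension at most `1`. -/
def projDimLEOne (R : Type u) [Ring R] : ObjectProperty (ModuleCat.{u} R) :=
  fun M => ModuleCat.isFG R M ∧ projectiveDimension M ≤ 1

/-- `M₁, …, Mₙ` is a complete set of representatives of the isomorphism classes of finitely
generated indecomposable `R`-modules. -/
structure IsCompleteSetOfIndecomposables (R : Type u) [Ring R] {n : ℕ}
    (M : Fin n → ModuleCat.{u} R) : Prop where
  finite : ∀ i, ModuleCat.isFG R (M i)
  indecomposable : ∀ i, Indecomposable (M i)
  eq_of_iso : ∀ i j, Nonempty (M i ≅ M j) → i = j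
  exists_iso : ∀ X : ModuleCat.{u} R, ModuleCat.isFG R X → Indecomposable X →
    ∃ i, Nonempty (X ≅ M i)

/-- `Λ` is an Auslander algebra over `k`: for some finite dimensional `k`-algebra `A` of finite
type, with complete set `M₁, …, Mₙ` of representatives of the indecomposable right `A`-modules,
`Λ` is isomorphic to the endomorphism algebra of `M₁ ^ m₁ ⊕ ⋯ ⊕ Mₙ ^ mₙ` with all `mᵢ ≥ 1`.
The choice `mᵢ = 1` gives the basic algebra in its Morita equivalence class, the other choices give
the remaining algebras of that class. Right `A`-modules are left `Aᵐᵒᵖ`-modules, and the product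
in `End` is the composition of maps, `(f * g) x = f (g x)`. -/
def IsAuslanderAlgebra (k : Type v) [Field k] (Λ : Type u) [Ring Λ] [Algebra k Λ] : Prop :=
  ∃ (A : Type u) (_ : Ring A) (_ : Algebra k A), Module.Finite k A ∧
    ∃ (n : ℕ) (M : Fin n → ModuleCat.{u} Aᵐᵒᵖ) (m : Fin n → ℕ),
      IsCompleteSetOfIndecomposables Aᵐᵒᵖ M ∧ (∀ i, 1 ≤ m i) ∧
      Nonempty (Λ ≃ₐ[k] End (ModuleCat.of Aᵐᵒᵖ (∀ i, Fin (m i) → M i)))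

/-! Both directions pass through a projective-injective module `Q` over R = `Λᵐᵒᵖ` with an exact
sequence 0 → R → Q^ι → Q^κ, that is, through dominant dimension at least 2.

Suppose Λ is the endomorphism ring of an additive generator N of the finitely generated modules over
C = `Aᵐᵒᵖ`. Take an injective cogenerator Y over C and put Q = Hom_C(N, Y). Applying Hom_C(N, -) to
an injective copresentation of N gives the sequence above. A finitely generated submodule of a power
of Q has a syzygy Hom_C(N, K), which is projective because K is in add N. Conversely, if Hom(K, Q) =
0, then Hom(K, R) and Ext¹(K, R) vanish, so a nonzero such K cannot lie in a module of projective
dimension at most 1 (`eq_bot_of_torsion_of_projectiveDimension_le_one`). Hence P¹ is the class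
cogenerated by the injective module Q, which gives a hereditary torsion pair. Injective members of
P¹ are summands of powers of Q, hence projective.

Conversely, heredity lets a module of P¹ embed in an injective module of P¹, and (b) makes that
injective projective. Embed R in such a V₀, then V₀/R, which is again in P¹, in such a V₁, and put Q
= V₀ × V₁, B = End_R(Q). The double centralizer property gives R = End_B(Q). A B-module presented by
a matrix M : Q^b → Q^a is Hom_R(ker M, Q); the image of M lies in P¹, so ker M is projective and the
module is in add Q (`IsTorsionPair.isSummandOfPower_end`). The k-dual of Q is then an additive
generator over `Bᵐᵒᵖ` with endomorphism ring Λ, and Krull–Schmidt writes it as a product of powers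
of all the indecomposables. -/

/-! ### Fitting's lemma and Krull–Schmidt decompositions. -/

section Indecomposable

/-- A module is indecomposable if it is nonzero and has no nontrivial complemented submodule. -/
structure IsIndecomposableModule (R X : Type*) [Ring R] [AddCommGroup X] [Module R X] : Prop where
  nontrivial : Nontrivial X
  eq_bot_or_eq_bot : ∀ p q : Submodule R X, IsCompl p q → p = ⊥ ∨ q = ⊥

theorem indecomposable_iff_isIndecomposableModule {R : Type u} [Ring R] (X : ModuleCat.{u} R) :
    Indecomposable X ↔ IsIndecomposableModule R X := by
  have hz : ∀ Y : ModuleCat.{u} R, Limits.IsZero Y ↔ Subsingleton Y :=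
    fun Y => ModuleCat.isZero_iff_subsingleton
  constructor
  · rintro ⟨h0, h⟩
    refine ⟨not_subsingleton_iff_nontrivial.mp ((hz X).not.mp h0), fun p q hpq => ?_⟩
    have e : ModuleCat.of R p ⊞ ModuleCat.of R q ≅ X :=
      ModuleCat.biprodIsoProd _ _ ≪≫ (Submodule.prodEquivOfIsCompl p q hpq).toModuleIso
    rcases h _ _ e.symm with h | h
    · left
      rw [hz] at h
      exact Submodule.subsingleton_iff_eq_bot.mp h
    · right
      rw [hz] at h
      exact Submodule.subsingleton_iff_eq_bot.mp h
  · rintro ⟨h0, h⟩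
    refine ⟨(hz X).not.mpr (not_subsingleton_iff_nontrivial.mpr h0), fun Y Z e => ?_⟩
    let e' : (Y × Z) ≃ₗ[R] X := (e ≪≫ ModuleCat.biprodIsoProd _ _).symm.toLinearEquiv
    have hc : IsCompl (LinearMap.range (LinearMap.inl R Y Z))
        (LinearMap.range (LinearMap.inr R Y Z)) := LinearMap.isCompl_range_inl_inr
    have hc' := hc.map (Submodule.orderIsoMapComap e')
    rw [hz, hz]
    rcases h _ _ hc' with h | h
    · left
      rw [map_eq_bot_iff, LinearMap.range_eq_bot] at h
      exact ⟨fun a b => by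
        have := congrArg Prod.fst (LinearMap.congr_fun h (a - b))
        simpa [sub_eq_zero] using this⟩
    · right
      rw [map_eq_bot_iff, LinearMap.range_eq_bot] at h
      exact ⟨fun a b => by
        have := congrArg Prod.snd (LinearMap.congr_fun h (a - b))
        simpa [sub_eq_zero] using this⟩

variable {R : Type*} [Ring R]

/-- Working with submodules of a fixed Artinian `X` makes splitting a well-founded recursion: both
summands of a proper decomposition are strictly smaller. -/
theorem Submodule.exists_pi_indecomposable {X : Type*} [AddCommGroup X] [Module R X]
    [IsArtinian R X] (p : Submodule R X) :
    ∃ (ι : Type) (_ : Finite ι) (Y : ι → Submodule R X),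
      (∀ i, IsIndecomposableModule R (Y i)) ∧ Nonempty (p ≃ₗ[R] ∀ i, Y i) := by
  induction p using WellFoundedLT.induction with
  | ind p ih =>
  by_cases h0 : p = ⊥
  · subst h0
    exact ⟨Empty, inferInstance, Empty.elim, fun i => i.elim, ⟨0, 0,
      fun _ => Subsingleton.elim _ _, fun _ => Subsingleton.elim _ _⟩⟩
  by_cases hp : IsIndecomposableModule R p
  · exact ⟨Unit, inferInstance, fun _ => p, fun _ => hp,
      ⟨(LinearEquiv.funUnique Unit R p).symm⟩⟩
  have hnt : Nontrivial p := (Submodule.nontrivial_iff_ne_bot).mpr h0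
  have hex : ∃ a b : Submodule R p, IsCompl a b ∧ a ≠ ⊥ ∧ b ≠ ⊥ := by
    by_contra! hcon
    exact hp ⟨hnt, fun a b hab => or_iff_not_imp_left.mpr (hcon a b hab)⟩
  obtain ⟨a, b, hab, ha, hb⟩ := hex
  have hlt : ∀ a b : Submodule R p, IsCompl a b → b ≠ ⊥ → a.map p.subtype < p := by
    intro a b hab hb
    refine lt_of_le_of_ne (Submodule.map_subtype_le p a) fun heq => hb ?_
    have : a = ⊤ := by
      apply Submodule.map_injective_of_injective p.injective_subtype
      rw [heq, Submodule.map_subtype_top]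
    subst this
    exact eq_bot_of_top_isCompl hab
  obtain ⟨ι, _, Y, hY, ⟨eY⟩⟩ := ih _ (hlt a b hab hb)
  obtain ⟨κ, _, Z, hZ, ⟨eZ⟩⟩ := ih _ (hlt b a hab.symm ha)
  refine ⟨ι ⊕ κ, inferInstance, Sum.elim Y Z, by rintro (i | i); exacts [hY i, hZ i], ⟨?_⟩⟩
  exact (Submodule.prodEquivOfIsCompl a b hab).symm ≪≫ₗ
    LinearEquiv.prodCongr (p.equivSubtypeMap a ≪≫ₗ eY) (p.equivSubtypeMap b ≪≫ₗ eZ) ≪≫ₗ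
    (LinearEquiv.sumPiEquivProdPi R ι κ (fun i => ↥(Sum.elim Y Z i))).symm

theorem exists_pi_indecomposable (X : Type*) [AddCommGroup X] [Module R X] [IsArtinian R X] :
    ∃ (ι : Type) (_ : Finite ι) (Y : ι → Submodule R X),
      (∀ i, IsIndecomposableModule R (Y i)) ∧ Nonempty (X ≃ₗ[R] ∀ i, Y i) := by
  obtain ⟨ι, h, Y, hY, ⟨e⟩⟩ := Submodule.exists_pi_indecomposable (⊤ : Submodule R X)
  exact ⟨ι, h, Y, hY, ⟨Submodule.topEquiv.symm ≪≫ₗ e⟩⟩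

variable {X : Type*} [AddCommGroup X] [Module R X]

theorem IsIndecomposableModule.isNilpotent_or_isUnit [IsArtinian R X] [IsNoetherian R X]
    (h : IsIndecomposableModule R X) (f : Module.End R X) : IsNilpotent f ∨ IsUnit f := by
  obtain ⟨n, hn⟩ := Filter.eventually_atTop.mp f.eventually_isCompl_ker_pow_range_pow
  -- The exponent is positive, so one factor `f` can be split off below.
  have hc := hn (n + 1) (by omega)
  rcases h.eq_bot_or_eq_bot _ _ hc with h1 | h1
  · right
    have hinj : Function.Injective f := by
      have : Function.Injective (f ^ (n + 1)) := LinearMap.ker_eq_bot.mp h1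
      rw [pow_succ] at this
      exact Function.Injective.of_comp (f := ⇑(f ^ n)) this
    exact (Module.End.isUnit_iff f).mpr (IsArtinian.bijective_of_injective_endomorphism f hinj)
  · left
    exact ⟨n + 1, LinearMap.range_eq_bot.mp h1⟩

/-- The endomorphism ring is local: normalise the sum to 1; if one term is nilpotent, the other is 1
minus a nilpotent. -/
theorem IsIndecomposableModule.isUnit_or_isUnit_of_add [IsArtinian R X] [IsNoetherian R X]
    (h : IsIndecomposableModule R X) {f g : Module.End R X} (hfg : IsUnit (f + g)) :
    IsUnit f ∨ IsUnit g := by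
  obtain ⟨w, hw⟩ := hfg
  have h1 : (↑w⁻¹ * f : Module.End R X) + ↑w⁻¹ * g = 1 := by
    rw [← mul_add, ← hw, Units.inv_mul]
  rcases h.isNilpotent_or_isUnit (↑w⁻¹ * f) with h2 | h2
  · right
    rw [← Units.isUnit_units_mul w⁻¹]
    rw [← eq_sub_iff_add_eq'] at h1
    rw [h1]
    exact h2.isUnit_one_sub
  · left
    rwa [Units.isUnit_units_mul] at h2

/-- If an isomorphism `X → X` factors through an indecomposable module, then `X` is isomorphic to
that module. -/
theorem IsIndecomposableModule.nonempty_equiv_of_isUnit_comp {Y : Type*} [AddCommGroup Y]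
    [Module R Y] (hX : Nontrivial X) (hY : IsIndecomposableModule R Y) (s : Y →ₗ[R] X)
    (t : X →ₗ[R] Y) (hst : IsUnit (s ∘ₗ t : Module.End R X)) : Nonempty (X ≃ₗ[R] Y) := by
  obtain ⟨hi, hs⟩ := (Module.End.isUnit_iff _).mp hst
  have hti : Function.Injective t := Function.Injective.of_comp (f := s) hi
  have hc : IsCompl (LinearMap.range t) (LinearMap.ker s) := by
    constructor
    · rw [Submodule.disjoint_def]
      rintro _ ⟨x, rfl⟩ hx
      rw [(injective_iff_map_eq_zero _).mp hi x hx, map_zero]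
    · rw [codisjoint_iff, eq_top_iff]
      intro y _
      obtain ⟨x, hx⟩ := hs (s y)
      exact Submodule.mem_sup.mpr ⟨t x, ⟨x, rfl⟩, y - t x, by
        rw [LinearMap.mem_ker, map_sub, sub_eq_zero]; exact hx.symm, by abel⟩
  rcases hY.eq_bot_or_eq_bot _ _ hc with h | h
  · rw [LinearMap.range_eq_bot] at h
    obtain ⟨x, hx⟩ := exists_ne (0 : X)
    exact absurd (hti (by simp [h])) hx
  · refine ⟨LinearEquiv.ofBijective t ⟨hti, ?_⟩⟩
    rw [h] at hc
    exact LinearMap.range_eq_top.mp (eq_top_of_isCompl_bot hc)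

/-- An indecomposable module of finite length that is a retract of a finite product of
indecomposable modules is isomorphic to one of the factors. -/
theorem IsIndecomposableModule.exists_equiv_of_retract_pi [IsArtinian R X] [IsNoetherian R X]
    (h : IsIndecomposableModule R X) {ι : Type*} [Finite ι] {Y : ι → Type*}
    [∀ i, AddCommGroup (Y i)] [∀ i, Module R (Y i)] (hY : ∀ i, IsIndecomposableModule R (Y i))
    (s : X →ₗ[R] ∀ i, Y i) (r : (∀ i, Y i) →ₗ[R] X) (hrs : r ∘ₗ s = LinearMap.id) :
    ∃ i, Nonempty (X ≃ₗ[R] Y i) := by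
  classical
  have := Fintype.ofFinite ι
  have hnt := h.nontrivial
  by_contra! hcon
  -- The identity is the sum of its components through the factors, and by locality one component is
  -- a unit.
  have hsum : ∑ i, ((r ∘ₗ LinearMap.single R Y i) ∘ₗ (LinearMap.proj i ∘ₗ s) : Module.End R X)
      = 1 := by
    ext x
    have : ∑ i, Pi.single i (s x i) = s x := Finset.univ_sum_single (s x)
    simp only [LinearMap.sum_apply, LinearMap.comp_apply, LinearMap.coe_single,
      LinearMap.proj_apply, ← map_sum, this]
    exact LinearMap.congr_fun hrs x
  have hnu : ¬ IsUnit (∑ i, ((r ∘ₗ LinearMap.single R Y i) ∘ₗ (LinearMap.proj i ∘ₗ s) :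
      Module.End R X)) := by
    refine Finset.sum_induction _ (fun f : Module.End R X => ¬ IsUnit f) (fun f g hf hg hfg => ?_)
      not_isUnit_zero fun i _ hi => ?_
    · exact (h.isUnit_or_isUnit_of_add hfg).elim hf hg
    · exact not_nonempty_iff.mpr (hcon i) ((hY i).nonempty_equiv_of_isUnit_comp hnt _ _ hi)
  exact hnu (hsum ▸ isUnit_one)

end Indecomposable

/-! ### Membership in add Z. -/

section InAdd

variable (R : Type*) [Ring R]

/-- `X` is a direct summand of a finite power of `Z`. -/
def IsSummandOfPower (Z X : Type*) [AddCommGroup Z] [Module R Z] [AddCommGroup X] [Module R X] :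
    Prop :=
  ∃ (ι : Type) (_ : Finite ι) (s : X →ₗ[R] (ι → Z)) (r : (ι → Z) →ₗ[R] X), r ∘ₗ s = LinearMap.id

variable {R} {X Y Z : Type*} [AddCommGroup X] [Module R X] [AddCommGroup Y] [Module R Y]
  [AddCommGroup Z] [Module R Z]

theorem IsSummandOfPower.of_retract (h : IsSummandOfPower R Z Y) (s : X →ₗ[R] Y) (r : Y →ₗ[R] X)
    (hrs : r ∘ₗ s = LinearMap.id) : IsSummandOfPower R Z X := by
  obtain ⟨ι, hι, s', r', h'⟩ := h
  refine ⟨ι, hι, s' ∘ₗ s, r ∘ₗ r', ?_⟩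
  rw [LinearMap.comp_assoc, ← LinearMap.comp_assoc s s' r', h', LinearMap.id_comp, hrs]

theorem IsSummandOfPower.congr (h : IsSummandOfPower R Z Y) (e : X ≃ₗ[R] Y) :
    IsSummandOfPower R Z X :=
  h.of_retract e.toLinearMap e.symm.toLinearMap (by ext; simp)

theorem isSummandOfPower_power (ι : Type) [Finite ι] : IsSummandOfPower R Z (ι → Z) :=
  ⟨ι, inferInstance, LinearMap.id, LinearMap.id, rfl⟩

theorem isSummandOfPower_pi {ι : Type} [Finite ι] {Y : ι → Type*} [∀ i, AddCommGroup (Y i)]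
    [∀ i, Module R (Y i)] (h : ∀ i, IsSummandOfPower R Z (Y i)) :
    IsSummandOfPower R Z (∀ i, Y i) := by
  choose κ hκ s r hrs using h
  refine ⟨Σ i, κ i, inferInstance, LinearMap.pi fun j => LinearMap.proj j.2 ∘ₗ s j.1 ∘ₗ
    LinearMap.proj j.1, LinearMap.pi fun i => r i ∘ₗ LinearMap.pi fun j =>
    LinearMap.proj (⟨i, j⟩ : Σ i, κ i), ?_⟩
  refine LinearMap.ext fun x => funext fun i => ?_
  exact LinearMap.congr_fun (hrs i) (x i)

theorem IsSummandOfPower.trans {W : Type*} [AddCommGroup W] [Module R W]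
    (h : IsSummandOfPower R Z X) (h' : IsSummandOfPower R W Z) : IsSummandOfPower R W X := by
  obtain ⟨ι, hι, s, r, hrs⟩ := h
  exact (isSummandOfPower_pi fun _ => h').of_retract s r hrs

theorem IsSummandOfPower.finite [Module.Finite R Z] (h : IsSummandOfPower R Z X) :
    Module.Finite R X := by
  obtain ⟨ι, hι, s, r, hrs⟩ := h
  exact Module.Finite.of_surjective r fun x => ⟨s x, LinearMap.congr_fun hrs x⟩

theorem IsSummandOfPower.projective [Module.Projective R Z] (h : IsSummandOfPower R Z X) :
    Module.Projective R X := by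
  obtain ⟨ι, hι, s, r, hrs⟩ := h
  classical
  have := Fintype.ofFinite ι
  have : Module.Projective R (ι → Z) :=
    Module.Projective.of_equiv (DFinsupp.linearEquivFunOnFintype (R := R) (M := fun _ : ι => Z))
  exact Module.Projective.of_split s r hrs

theorem Module.Projective.isSummandOfPower [Module.Finite R X] [Module.Projective R X] :
    IsSummandOfPower R R X := by
  obtain ⟨n, f, hf⟩ := Module.Finite.exists_fin' R X
  obtain ⟨g, hg⟩ := Module.projective_lifting_property f LinearMap.id hf
  exact ⟨Fin n, inferInstance, g, f, hg⟩

end InAdd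

/-! ### Hom groups as modules under precomposition. -/

section HomModule

/-- The module `Hom_C(N, Y)` over a ring `R` acting on `N` from the right through `ρ`. -/
def HomModule {C R N : Type*} (Y : Type*) [Ring C] [Ring R] [AddCommGroup N] [Module C N]
    [AddCommGroup Y] [Module C Y] (_ : R →+* (Module.End C N)ᵐᵒᵖ) : Type _ :=
  N →ₗ[C] Y

namespace HomModule

variable {C R N Y : Type*} [Ring C] [Ring R] [AddCommGroup N] [Module C N]
    [AddCommGroup Y] [Module C Y] (ρ : R →+* (Module.End C N)ᵐᵒᵖ)

instance : AddCommGroup (HomModule Y ρ) := inferInstanceAs (AddCommGroup (N →ₗ[C] Y))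

instance : FunLike (HomModule Y ρ) N Y := inferInstanceAs (FunLike (N →ₗ[C] Y) N Y)

instance : LinearMapClass (HomModule Y ρ) C N Y :=
  inferInstanceAs (LinearMapClass (N →ₗ[C] Y) C N Y)

/-- An element of `HomModule Y ρ`, from a linear map. -/
def of (f : N →ₗ[C] Y) : HomModule Y ρ := f

variable {ρ}

/-- An element of `HomModule Y ρ` as a linear map. -/
def hom (f : HomModule Y ρ) : N →ₗ[C] Y := f

@[simp] theorem of_apply (f : N →ₗ[C] Y) (x : N) : of ρ f x = f x := rfl

@[simp] theorem hom_apply (f : HomModule Y ρ) (x : N) : f.hom x = f x := rfl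

@[ext] theorem ext {f g : HomModule Y ρ} (h : ∀ x, f x = g x) : f = g := LinearMap.ext h

@[simp] theorem add_apply (f g : HomModule Y ρ) (x : N) : (f + g) x = f x + g x := rfl

@[simp] theorem zero_apply (x : N) : (0 : HomModule Y ρ) x = 0 := rfl

@[simp] theorem sum_apply {ι : Type*} (s : Finset ι) (f : ι → HomModule Y ρ) (x : N) :
    (∑ i ∈ s, f i) x = ∑ i ∈ s, f i x :=
  LinearMap.sum_apply s f x

/-- Precomposition reverses products; the opposite ring in the target of `ρ` turns it into a left
action. -/
instance : SMul R (HomModule Y ρ) := ⟨fun r f => of ρ (f.hom ∘ₗ (ρ r).unop)⟩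

@[simp] theorem smul_apply (r : R) (f : HomModule Y ρ) (x : N) :
    (r • f) x = f ((ρ r).unop x) := rfl

instance : Module R (HomModule Y ρ) where
  one_smul f := by ext; simp
  mul_smul r s f := by ext; simp
  smul_zero r := by ext; simp
  smul_add r f g := by ext; simp
  add_smul r s f := by ext; simp
  zero_smul f := by ext; simp

section Field

variable {k X S R' : Type*} [Field k] [AddCommGroup X] [Module k X] [AddCommGroup S] [Module k S]
  [Ring R'] (σ : R' →+* (Module.End k X)ᵐᵒᵖ)

instance : Module k (HomModule S σ) := inferInstanceAs (Module k (X →ₗ[k] S))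

variable {σ}

@[simp] theorem field_smul_apply (c : k) (f : HomModule S σ) (x : X) : (c • f) x = c • f x := rfl

instance [Module.Finite k X] [Module.Finite k S] : Module.Finite k (HomModule S σ) :=
  inferInstanceAs (Module.Finite k (X →ₗ[k] S))

theorem isScalarTower [Algebra k R']
    (h : ∀ (c : k) (x : X), (σ (algebraMap k R' c)).unop x = c • x) :
    IsScalarTower k R' (HomModule S σ) :=
  ⟨fun c r f => by
    ext x
    have h1 : (c • r) = r * algebraMap k R' c := by
      rw [Algebra.smul_def, Algebra.commutes]
    rw [h1, field_smul_apply, smul_apply, smul_apply, map_mul, MulOpposite.unop_mul,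
      Module.End.mul_apply, h, map_smul]⟩

end Field

end HomModule

end HomModule

/-! ### Duality over the base field. -/

section Dual

variable {k : Type v} [Field k] {S : Type*} [AddCommGroup S] [Module k S]

theorem exists_linearMap_apply_ne_zero (e : S ≃ₗ[k] k) {X : Type*} [AddCommGroup X] [Module k X]
    {x : X} (hx : x ≠ 0) : ∃ f : X →ₗ[k] S, f x ≠ 0 := by
  obtain ⟨f, hf⟩ : ∃ f : X →ₗ[k] k, f x ≠ 0 := by
    by_contra! h
    exact hx ((Module.forall_dual_apply_eq_zero_iff k x).mp h)
  exact ⟨e.symm.toLinearMap ∘ₗ f, by simpa using hf⟩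

variable (X : Type*) [AddCommGroup X] [Module k X]

theorem bijective_linearMap_eval (e : S ≃ₗ[k] k) [Module.Finite k X] :
    Function.Bijective (LinearMap.applyₗ (R := k) (M := X) (M₂ := S)) := by
  have hS : Module.Finite k S := Module.Finite.equiv e.symm
  have h1 : Module.finrank k S = 1 := by rw [e.finrank_eq, Module.finrank_self]
  have hinj : Function.Injective (LinearMap.applyₗ (R := k) (M := X) (M₂ := S)) := by
    rw [injective_iff_map_eq_zero]
    intro x hx
    by_contra hne
    obtain ⟨f, hf⟩ := exists_linearMap_apply_ne_zero e hne
    exact hf (LinearMap.congr_fun hx f)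
  refine ⟨hinj, (LinearMap.injective_iff_surjective_of_finrank_eq_finrank ?_).mp hinj⟩
  rw [Module.finrank_linearMap, Module.finrank_linearMap, h1, mul_one, mul_one]

/-- A finite dimensional space is the double dual of itself. -/
noncomputable def linearMapEvalEquiv (e : S ≃ₗ[k] k) [Module.Finite k X] :
    X ≃ₗ[k] ((X →ₗ[k] S) →ₗ[k] S) :=
  LinearEquiv.ofBijective _ (bijective_linearMap_eval X e)

variable {X}

theorem apply_linearMapEvalEquiv_symm (e : S ≃ₗ[k] k) [Module.Finite k X]
    (Φ : (X →ₗ[k] S) →ₗ[k] S) (f : X →ₗ[k] S) : f ((linearMapEvalEquiv X e).symm Φ) = Φ f :=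
  LinearMap.congr_fun ((linearMapEvalEquiv X e).apply_symm_apply Φ) f

end Dual

/-- The field embeds in `C`, so it has a copy in the universe of `C`. Taking duals with values in
this copy keeps them in that universe. -/
theorem exists_linearEquiv_of_nontrivial_algebra (k : Type v) [Field k] (C : Type u) [Ring C]
    [Algebra k C] [Nontrivial C] :
    ∃ (S : Type u) (_ : AddCommGroup S) (_ : Module k S), Nonempty (S ≃ₗ[k] k) := by
  have : Small.{u} k := small_of_injective (FaithfulSMul.algebraMap_injective k C)
  exact ⟨Shrink.{u} k, inferInstance, inferInstance, ⟨Shrink.linearEquiv k k⟩⟩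

/-- A finite dimensional algebra has a finitely generated injective cogenerator. -/
theorem exists_injective_cogenerator (k : Type v) [Field k] (C : Type u) [Ring C] [Algebra k C]
    [Module.Finite k C] :
    ∃ (Y : Type u) (_ : AddCommGroup Y) (_ : Module C Y), Module.Finite C Y ∧
      Module.Injective C Y ∧ ∀ (X : Type u) [AddCommGroup X] [Module C X] [Module.Finite C X],
        ∃ (ι : Type) (_ : Finite ι) (f : X →ₗ[C] (ι → Y)), Function.Injective f := by
  rcases subsingleton_or_nontrivial C with hC | hC
  · refine ⟨PUnit, inferInstance, inferInstance, inferInstance,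
      ⟨fun _ _ _ _ _ _ _ _ _ => ⟨0, fun _ => rfl⟩⟩, fun X _ _ _ => ?_⟩
    have := Module.subsingleton C X
    exact ⟨Unit, inferInstance, 0, Function.injective_of_subsingleton _⟩
  obtain ⟨S, _, _, ⟨e⟩⟩ := exists_linearEquiv_of_nontrivial_algebra k C
  have hS : Module.Finite k S := Module.Finite.equiv e.symm
  -- The cogenerator will be Hom_k(C, S), with `C` acting through right multiplication on the
  -- argument.
  obtain ⟨σ, hσ⟩ : ∃ σ : C →+* (Module.End k C)ᵐᵒᵖ, ∀ c x, (σ c).unop x = x * c :=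
    ⟨{ toFun := fun c => MulOpposite.op (LinearMap.mulRight k c)
       map_one' := MulOpposite.unop_injective (by ext; simp)
       map_mul' := fun a b => MulOpposite.unop_injective (by ext; simp [mul_assoc])
       map_zero' := MulOpposite.unop_injective (by ext; simp)
       map_add' := fun a b => MulOpposite.unop_injective (by ext; simp [mul_add]) },
      fun _ _ => rfl⟩
  have htower : IsScalarTower k C (HomModule S σ) := HomModule.isScalarTower fun c x => by
    simp [hσ, Algebra.smul_def, Algebra.commutes]
  -- the adjunction `Hom_C(X, W) = Hom_k(X, k)`
  have adj : ∀ (X : Type u) [AddCommGroup X] [Module C X] [Module k X] [IsScalarTower k C X]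
      (l : X →ₗ[k] S), ∃ f : X →ₗ[C] HomModule S σ, ∀ x, f x (1 : C) = l x := by
    intro X _ _ _ _ l
    refine ⟨{ toFun := fun x => HomModule.of σ
                (l ∘ₗ (LinearMap.toSpanSingleton C X x).restrictScalars k)
              map_add' := fun x y => by ext; simp
              map_smul' := fun r x => by ext; simp [hσ, mul_smul] }, fun x => by simp⟩
  have key : ∀ (X : Type u) [AddCommGroup X] [Module C X] (f : X →ₗ[C] HomModule S σ)
      (x : X) (c : C),
      f x c = f (c • x) (1 : C) := by
    intro X _ _ f x c
    rw [map_smul, HomModule.smul_apply]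
    simp [hσ]
  refine ⟨HomModule S σ, inferInstance, inferInstance,
    Module.Finite.of_restrictScalars_finite k C (HomModule S σ), ⟨?_⟩, ?_⟩
  · intro X Y _ _ _ _ i hi g
    let := Module.restrictScalars k C X
    let := Module.restrictScalars k C Y
    have := IsScalarTower.restrictScalars k C X
    have := IsScalarTower.restrictScalars k C Y
    -- Over the field `i` splits; by adjunction, a `C`-linear extension only needs a `k`-linear one
    -- of evaluation at 1.
    obtain ⟨p, hp⟩ := (i.restrictScalars k).exists_leftInverse_of_injective
      (LinearMap.ker_eq_bot.mpr hi)
    let l : X →ₗ[k] S :=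
      { toFun := fun x => g x (1 : C)
        map_add' := fun x y => by simp
        map_smul' := fun c x => by
          rw [← IsScalarTower.algebraMap_smul C c x, map_smul, IsScalarTower.algebraMap_smul]
          rfl }
    obtain ⟨f, hf⟩ := adj Y (l ∘ₗ p)
    refine ⟨f, fun x => ?_⟩
    ext c
    rw [key, key X g, ← map_smul, hf]
    exact congrArg l (LinearMap.congr_fun hp (c • x))
  · intro X _ _ _
    let := Module.restrictScalars k C X
    have := IsScalarTower.restrictScalars k C X
    have : Module.Finite k X := Module.Finite.trans C X
    let b := Module.finBasis k X
    choose f hf using fun i => adj X (e.symm.toLinearMap ∘ₗ b.coord i)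
    refine ⟨Fin (Module.finrank k X), inferInstance, LinearMap.pi f, ?_⟩
    rw [injective_iff_map_eq_zero]
    intro x hx
    refine b.ext_elem fun i => ?_
    have h1 : f i x (1 : C) = 0 := by
      have h2 : f i x = 0 := congrFun hx i
      rw [h2]; rfl
    rw [hf] at h1
    simpa using h1

/-- If `Q` is an additive generator of the category of finitely generated `B`-modules, then its
dual is an additive generator of the category of finitely generated `Bᵐᵒᵖ`-modules. -/
theorem exists_dual_additive_generator (k : Type v) [Field k] (B : Type u) [Ring B] [Algebra k B]
    [Module.Finite k B] (Q : Type u) [AddCommGroup Q] [Module B Q] [Module.Finite B Q]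
    (hQ : ∀ (X : Type u) [AddCommGroup X] [Module B X] [Module.Finite B X],
      IsSummandOfPower B Q X) :
    ∃ (N : Type u) (_ : AddCommGroup N) (_ : Module Bᵐᵒᵖ N), Module.Finite Bᵐᵒᵖ N ∧
      (∀ (X : Type u) [AddCommGroup X] [Module Bᵐᵒᵖ X] [Module.Finite Bᵐᵒᵖ X],
        IsSummandOfPower Bᵐᵒᵖ N X) ∧
      ∃ e : (Module.End B Q)ᵐᵒᵖ ≃+* Module.End Bᵐᵒᵖ N, ∀ (c : k) (φ : Module.End B Q),
        (∀ q, φ q = algebraMap k B c • q) →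
          ∀ n, e (MulOpposite.op φ) n = algebraMap k Bᵐᵒᵖ c • n := by
  rcases subsingleton_or_nontrivial B with hB | hB
  · have := Module.subsingleton B Q
    refine ⟨PUnit, inferInstance, inferInstance, inferInstance, fun X _ _ _ => ?_, ?_⟩
    · have := Module.subsingleton Bᵐᵒᵖ X
      exact ⟨Unit, inferInstance, 0, 0, LinearMap.ext fun _ => Subsingleton.elim _ _⟩
    · exact ⟨⟨⟨0, 0, fun _ => Subsingleton.elim _ _, fun _ => Subsingleton.elim _ _⟩,
        fun _ _ => Subsingleton.elim _ _, fun _ _ => Subsingleton.elim _ _⟩,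
        fun _ _ _ _ => Subsingleton.elim _ _⟩
  obtain ⟨S, _, _, ⟨e⟩⟩ := exists_linearEquiv_of_nontrivial_algebra k B
  have hS : Module.Finite k S := Module.Finite.equiv e.symm
  let := Module.restrictScalars k B Q
  have := IsScalarTower.restrictScalars k B Q
  have : Module.Finite k Q := Module.Finite.trans B Q
  obtain ⟨σ, hσ⟩ : ∃ σ : Bᵐᵒᵖ →+* (Module.End k Q)ᵐᵒᵖ, ∀ b q, (σ b).unop q = b.unop • q :=
    ⟨RingHom.op (Algebra.lsmul k k Q).toRingHom, fun _ _ => rfl⟩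
  have htower : IsScalarTower k Bᵐᵒᵖ (HomModule S σ) := HomModule.isScalarTower fun c x => by
    rw [hσ]
    exact IsScalarTower.algebraMap_smul B c x
  refine ⟨HomModule S σ, inferInstance, inferInstance,
    Module.Finite.of_restrictScalars_finite k Bᵐᵒᵖ (HomModule S σ),
    fun X _ _ _ => ?_, ?_⟩
  · let := Module.restrictScalars k Bᵐᵒᵖ X
    have := IsScalarTower.restrictScalars k Bᵐᵒᵖ X
    have : Module.Finite k X := Module.Finite.trans Bᵐᵒᵖ X
    obtain ⟨τ, hτ⟩ : ∃ τ : B →+* (Module.End k X)ᵐᵒᵖ,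
        ∀ b x, (τ b).unop x = MulOpposite.op b • x :=
      ⟨(RingHom.op (Algebra.lsmul k k X).toRingHom).comp (RingEquiv.opOp B).toRingHom,
        fun _ _ => rfl⟩
    have htower' : IsScalarTower k B (HomModule S τ) := HomModule.isScalarTower fun c x => by
      rw [hτ]
      exact IsScalarTower.algebraMap_smul Bᵐᵒᵖ c x
    have : Module.Finite B (HomModule S τ) :=
      Module.Finite.of_restrictScalars_finite k B (HomModule S τ)
    -- The dual of `X` is a retract of a power of `Q`. Transposing `r` gives the section `f`;
    -- transposing `s` gives `Θ`, whose values in the double dual are brought back to `X` by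
    -- reflexivity.
    obtain ⟨ι, hι, s, r, hrs⟩ := hQ (HomModule S τ)
    classical
    have := Fintype.ofFinite ι
    let f : X →ₗ[Bᵐᵒᵖ] (ι → (HomModule S σ)) :=
      { toFun := fun x i => HomModule.of σ
          { toFun := fun q => r (Pi.single i q) x
            map_add' := fun q q' => by rw [Pi.single_add, map_add]; rfl
            map_smul' := fun c q => by
              rw [Pi.single_smul, LinearMap.map_smul_of_tower]; rfl }
        map_add' := fun x y => by ext i q; simp
        map_smul' := fun b x => by
          ext i q
          have h1 : Pi.single i (b.unop • q) = b.unop • (Pi.single i q : ι → Q) :=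
            (LinearMap.single B (fun _ : ι => Q) i).map_smul _ _
          simp only [HomModule.of_apply, LinearMap.coe_mk, AddHom.coe_mk, RingHom.id_apply,
            Pi.smul_apply, HomModule.smul_apply, hσ, h1, map_smul, hτ,
            MulOpposite.op_unop] }
    let Θ : (ι → (HomModule S σ)) → ((X →ₗ[k] S) →ₗ[k] S) := fun n =>
      { toFun := fun h => ∑ i, n i (s (HomModule.of τ h) i)
        map_add' := fun h h' => by
          rw [← Finset.sum_add_distrib]
          exact Finset.sum_congr rfl fun i _ => by
            rw [← map_add, ← Pi.add_apply, ← map_add]; rfl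
        map_smul' := fun c h => by
          rw [RingHom.id_apply, Finset.smul_sum]
          exact Finset.sum_congr rfl fun i _ => by
            rw [← map_smul, ← Pi.smul_apply, ← LinearMap.map_smul_of_tower]; rfl }
    let ev := linearMapEvalEquiv X e
    have hev : ∀ Φ (h : X →ₗ[k] S), h (ev.symm Φ) = Φ h :=
      fun Φ h => apply_linearMapEvalEquiv_symm e Φ h
    let g : (ι → (HomModule S σ)) →ₗ[Bᵐᵒᵖ] X :=
      { toFun := fun n => ev.symm (Θ n)
        map_add' := fun n n' => by
          rw [← map_add]
          congr 1
          ext h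
          simp [Θ, Finset.sum_add_distrib]
        map_smul' := fun b n => by
          apply ev.injective
          rw [LinearEquiv.apply_symm_apply]
          ext h
          have h1 : b.unop • HomModule.of τ h =
              HomModule.of τ (h ∘ₗ (Algebra.lsmul k k X) b) := by
            ext x; simp [hτ]
          have h2 : Θ (b • n) h = Θ n (h ∘ₗ (Algebra.lsmul k k X) b) := by
            refine Finset.sum_congr rfl fun i _ => ?_
            rw [← h1, map_smul, Pi.smul_apply, Pi.smul_apply, HomModule.smul_apply, hσ]
          rw [h2, ← hev]
          rfl }
    refine ⟨ι, hι, f, g, ?_⟩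
    refine LinearMap.ext fun x => ?_
    apply ev.injective
    change ev (ev.symm (Θ (f x))) = ev x
    rw [LinearEquiv.apply_symm_apply]
    ext h
    change ∑ i, r (Pi.single i (s (HomModule.of τ h) i)) x = h x
    rw [← HomModule.sum_apply, ← map_sum, Finset.univ_sum_single]
    exact congrArg (fun z : (HomModule S τ) => z x) (LinearMap.congr_fun hrs (HomModule.of τ h))
  -- `T` is transposition. Functionals separate points, so it is injective; reflexivity of `Q` lets
  -- every endomorphism of the dual be transposed back.
  · let T : (Module.End B Q)ᵐᵒᵖ →+* Module.End Bᵐᵒᵖ (HomModule S σ) :=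
      { toFun := fun φ =>
          { toFun := fun n => HomModule.of σ (n.hom ∘ₗ φ.unop.restrictScalars k)
            map_add' := fun n n' => by ext; simp
            map_smul' := fun b n => by ext; simp [hσ] }
        map_one' := by ext; simp
        map_mul' := fun φ ψ => by ext; simp
        map_zero' := by ext; simp
        map_add' := fun φ ψ => by ext; simp }
    have hT : ∀ φ n q, T φ n q = n (φ.unop q) := fun _ _ _ => rfl
    have hinj : Function.Injective T := by
      rw [injective_iff_map_eq_zero]
      intro φ hφ
      apply MulOpposite.unop_injective
      refine LinearMap.ext fun q => ?_
      by_contra hne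
      obtain ⟨f, hf⟩ := exists_linearMap_apply_ne_zero e hne
      refine hf ?_
      have := hT φ (HomModule.of σ f) q
      rw [hφ] at this
      exact this.symm
    have hsurj : Function.Surjective T := by
      intro g
      let ev := linearMapEvalEquiv Q e
      have hev : ∀ Φ (h : Q →ₗ[k] S), h (ev.symm Φ) = Φ h :=
        fun Φ h => apply_linearMapEvalEquiv_symm e Φ h
      let Ψ : Q → ((Q →ₗ[k] S) →ₗ[k] S) := fun q =>
        { toFun := fun h => g (HomModule.of σ h) q
          map_add' := fun h h' => by rw [← HomModule.add_apply, ← map_add]; rfl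
          map_smul' := fun c h => by
            rw [RingHom.id_apply, ← HomModule.field_smul_apply, ← LinearMap.map_smul_of_tower]
            rfl }
      let ψ : Module.End B Q :=
        { toFun := fun q => ev.symm (Ψ q)
          map_add' := fun q q' => by
            rw [← map_add]
            congr 1
            ext h
            simp [Ψ]
          map_smul' := fun b q => by
            apply ev.injective
            rw [LinearEquiv.apply_symm_apply]
            ext h
            have h1 : MulOpposite.op b • HomModule.of σ h =
              HomModule.of σ (h ∘ₗ (Algebra.lsmul k k Q) b) := by
              ext x; simp [hσ]
            have h2 : Ψ (b • q) h = Ψ q (h ∘ₗ (Algebra.lsmul k k Q) b) := by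
              change g (HomModule.of σ h) (b • q) = g (HomModule.of σ _) q
              rw [← h1, LinearMap.map_smul g, HomModule.smul_apply, hσ, MulOpposite.unop_op]
            rw [h2, ← hev]
            rfl }
      refine ⟨MulOpposite.op ψ, LinearMap.ext fun n => ?_⟩
      ext q
      exact hev (Ψ q) n
    refine ⟨RingEquiv.ofBijective T ⟨hinj, hsurj⟩, fun c φ hφ n => ?_⟩
    ext q
    rw [HomModule.smul_apply, hσ]
    exact congrArg n (hφ q)

/-! ### Projective dimension at most one. -/

section ProjectiveDimension

variable {R : Type u} [Ring R]

theorem projectiveDimension_le_one_iff {P X : Type u} [AddCommGroup P] [Module R P]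
    [AddCommGroup X] [Module R X] [Module.Projective R P] (f : P →ₗ[R] X)
    (hf : Function.Surjective f) :
    projectiveDimension (ModuleCat.of R X) ≤ 1 ↔ Module.Projective R (LinearMap.ker f) := by
  have hP : Projective f.shortComplexKer.X₂ :=
    (IsProjective.iff_projective (R := R) P).mp inferInstance
  have h1 := (LinearMap.shortExact_shortComplexKer hf).hasProjectiveDimensionLT_X₃_iff 0 hP
  rw [IsProjective.iff_projective, projective_iff_hasProjectiveDimensionLT_one]
  exact (projectiveDimension_le_iff (ModuleCat.of R X) 1).trans h1

theorem projectiveDimension_le_one_of_projective {X : Type u} [AddCommGroup X] [Module R X]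
    [Module.Projective R X] : projectiveDimension (ModuleCat.of R X) ≤ 1 := by
  rw [projectiveDimension_le_one_iff (LinearMap.id : X →ₗ[R] X) Function.surjective_id,
    LinearMap.ker_id]
  infer_instance

/-- The zero module has dimension `⊥`, so "at most 1 but not 1" means "less than 1", which is
projectivity. -/
theorem projective_of_projectiveDimension {X : ModuleCat.{u} R} (h : projectiveDimension X ≤ 1)
    (h' : projectiveDimension X ≠ 1) : Module.Projective R X := by
  have := (projectiveDimension_lt_iff (n := 1)).mp (lt_of_le_of_ne h h')
  exact (IsProjective.iff_projective (R := R) X).mpr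
    (projective_iff_hasProjectiveDimensionLT_one.mpr this)

theorem projectiveDimension_ne_one_of_projective {X : ModuleCat.{u} R} [h : Module.Projective R X] :
    projectiveDimension X ≠ 1 :=
  ne_of_lt <| (projectiveDimension_lt_iff (n := 1)).mpr <|
    projective_iff_hasProjectiveDimensionLT_one.mp
      ((IsProjective.iff_projective (R := R) X).mp h)

end ProjectiveDimension

theorem LinearMap.exists_comp_eq_of_ker_le {R M N L : Type*} [Ring R] [AddCommGroup M] [Module R M]
    [AddCommGroup N] [Module R N] [AddCommGroup L] [Module R L] (p : M →ₗ[R] N)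
    (hp : Function.Surjective p) (a : M →ₗ[R] L) (h : ker p ≤ ker a) :
    ∃ b : N →ₗ[R] L, ∀ x, b (p x) = a x := by
  refine ⟨(ker p).liftQ a h ∘ₗ (p.quotKerEquivOfSurjective hp).symm.toLinearMap, fun x => ?_⟩
  have : (p.quotKerEquivOfSurjective hp).symm (p x) = (ker p).mkQ x := by
    rw [LinearEquiv.symm_apply_eq]; rfl
  simp [this]

theorem Module.Injective.exists_extension {R : Type u} [Ring R] {Q : Type u} [AddCommGroup Q]
    [Module R Q] [Module.Injective R Q] {X Y : Type*} [AddCommGroup X] [Module R X]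
    [AddCommGroup Y] [Module R Y] (i : X →ₗ[R] Y) (hi : Function.Injective i) (f : X →ₗ[R] Q) :
    ∃ g : Y →ₗ[R] Q, ∀ x, g (i x) = f x := by
  obtain ⟨g, hg⟩ := Module.Injective.extension_property R Q X Y i hi f
  exact ⟨g, LinearMap.congr_fun hg⟩

/-! ### Torsion theory cogenerated by a projective-injective module. -/

section DominantDimension

variable {R : Type u} [Ring R] (Q : Type u) [AddCommGroup Q] [Module R Q]

theorem torsion_hom_pi_eq_zero {K : Type*} [AddCommGroup K] [Module R K]
    (hK : ∀ f : K →ₗ[R] Q, f = 0) {ι : Type*} {L : Type*} [AddCommGroup L] [Module R L]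
    (i : L →ₗ[R] (ι → Q)) (hi : Function.Injective i) (f : K →ₗ[R] L) : f = 0 := by
  refine LinearMap.ext fun x => hi (funext fun j => ?_)
  rw [LinearMap.zero_apply, map_zero]
  exact LinearMap.congr_fun (hK (LinearMap.proj j ∘ₗ i ∘ₗ f)) x

/-- Take the intersection of the kernels of all maps `X → Q`: a map from it to `Q` extends to `X` by
injectivity, hence is zero. The Artinian condition reduces the intersection to finitely many
kernels. -/
theorem exists_torsion_submodule [IsArtinianRing R] [Module.Injective R Q] (X : Type u)
    [AddCommGroup X] [Module R X] [Module.Finite R X] :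
    ∃ K : Submodule R X, (∀ f : K →ₗ[R] Q, f = 0) ∧
      (K = ⊥ → ∃ (ι : Type) (_ : Finite ι) (f : X →ₗ[R] (ι → Q)), Function.Injective f) := by
  refine ⟨⨅ f : X →ₗ[R] Q, LinearMap.ker f, fun f => ?_, fun hK => ?_⟩
  · obtain ⟨g, hg⟩ := Module.Injective.exists_extension _ (Submodule.injective_subtype _) f
    refine LinearMap.ext fun x => ?_
    rw [← hg]
    exact (Submodule.mem_iInf _).mp x.2 g
  · obtain ⟨p, ⟨ι, hι, f, hf⟩, hmin⟩ := IsArtinian.set_has_minimal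
      {p : Submodule R X | ∃ (ι : Type) (_ : Finite ι) (f : X →ₗ[R] (ι → Q)),
        LinearMap.ker f = p} ⟨_, Empty, inferInstance, 0, rfl⟩
    refine ⟨ι, hι, f, LinearMap.ker_eq_bot.mp ?_⟩
    rw [hf, eq_bot_iff, ← hK]
    refine le_iInf fun g x hx => ?_
    by_contra hgx
    let f' : X →ₗ[R] (Option ι → Q) := LinearMap.pi fun o => o.elim g fun i => LinearMap.proj i ∘ₗ f
    refine hmin _ ⟨Option ι, inferInstance, f', rfl⟩ (lt_of_le_of_ne (fun y hy => ?_) ?_)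
    · rw [← hf]
      exact funext fun i => congrFun (LinearMap.mem_ker.mp hy) (some i)
    · rintro rfl
      exact hgx (congrFun (LinearMap.mem_ker.mp hx) none)

/-- Since Hom(K, R) = Ext¹(K, R) = 0 and the syzygy ker p is projective, the pullback of 0 → ker p →
R^m → X → 0 along `K` splits, and the resulting map K → R^m is zero. -/
theorem eq_bot_of_torsion_of_projectiveDimension_le_one [IsArtinianRing R]
    [Module.Injective R Q]
    {ι κ : Type} [Finite ι] [Finite κ] (j : R →ₗ[R] (ι → Q)) (hj : Function.Injective j)
    (g : (ι → Q) →ₗ[R] (κ → Q)) (hjg : LinearMap.range j = LinearMap.ker g)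
    {X : Type u} [AddCommGroup X] [Module R X] [Module.Finite R X]
    (hX : projectiveDimension (ModuleCat.of R X) ≤ 1) (K : Submodule R X)
    (hK : ∀ f : K →ₗ[R] Q, f = 0) : K = ⊥ := by
  obtain ⟨m, p, hp⟩ := Module.Finite.exists_fin' R X
  have hproj : Module.Projective R (LinearMap.ker p) := (projectiveDimension_le_one_iff p hp).mp hX
  obtain ⟨n, _, i, r, hri⟩ := Module.Projective.isSummandOfPower (R := R) (X := LinearMap.ker p)
  have hinj : ∀ n : Type, Function.Injective (j.compLeft n) := fun n x y hxy =>
    funext fun a => hj (congrFun hxy a)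
  have curry_inj : ∀ n κ : Type, Function.Injective (LinearEquiv.curry R Q n κ).symm :=
    fun n κ => LinearEquiv.injective _
  -- every map from the preimage of `K` to a module cogenerated by `Q` factors through `p`
  let E := K.comap p
  let pE : E →ₗ[R] K := (p ∘ₗ E.subtype).codRestrict K fun x => x.2
  have hpE : Function.Surjective pE := fun y => by
    obtain ⟨x, hx⟩ := hp y
    exact ⟨⟨x, show p x ∈ K by rw [hx]; exact y.2⟩, Subtype.ext hx⟩
  have hzero : ∀ {α : Type} {L : Type u} [AddCommGroup L] [Module R L] (b : L →ₗ[R] (α → Q)),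
      Function.Injective b → ∀ a : E →ₗ[R] L, (∀ x : E, p x = 0 → a x = 0) → ∀ x, a x = 0 := by
    intro α L _ _ b hb a ha x
    obtain ⟨c, hc⟩ := LinearMap.exists_comp_eq_of_ker_le pE hpE a
      fun x hx => ha x (congrArg Subtype.val (LinearMap.mem_ker.mp hx))
    rw [← hc, torsion_hom_pi_eq_zero Q hK b hb c, LinearMap.zero_apply]
  -- Extend ker p → R^n → Q^(n×ι) to R^m. On `E` the composite with `g` kills ker p, so it is zero
  -- and `φ` lands in R^n.
  obtain ⟨φ, hφ⟩ := Module.Injective.exists_extension (LinearMap.ker p).subtype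
    (Submodule.injective_subtype _) (j.compLeft n ∘ₗ i)
  have hgφ : ∀ x : E, g.compLeft n (φ x) = 0 := by
    refine hzero (LinearEquiv.curry R Q n κ).symm.toLinearMap (curry_inj n κ)
      (g.compLeft n ∘ₗ φ ∘ₗ E.subtype) fun x hx => ?_
    have h1 := hφ ⟨x, hx⟩
    change g.compLeft n (φ x) = 0
    rw [show φ x = _ from h1]
    refine funext fun a => ?_
    exact LinearMap.mem_ker.mp (hjg ▸ LinearMap.mem_range_self j (i ⟨x, hx⟩ a))
  have hrange : ∀ x : E, φ x ∈ LinearMap.range (j.compLeft n) := by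
    intro x
    have h1 : ∀ a, ∃ y, j y = φ x a := fun a => by
      have : φ x a ∈ LinearMap.range j := hjg ▸ congrFun (hgφ x) a
      exact this
    choose y hy using h1
    exact ⟨y, funext hy⟩
  let s : E →ₗ[R] (n → R) := (LinearEquiv.ofInjective _ (hinj n)).symm.toLinearMap ∘ₗ
    (φ ∘ₗ E.subtype).codRestrict _ hrange
  have hs : ∀ x, j.compLeft n (s x) = φ x := fun x =>
    LinearEquiv.ofInjective_symm_apply (f := j.compLeft n) (h := hinj n) ⟨φ x, hrange x⟩
  -- `r ∘ s` is a retraction of `E` onto ker p; its difference from the inclusion factors through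
  -- `K`, so it vanishes and `E` is ker p.
  have hsplit : ∀ x : E, (x : Fin m → R) - (r (s x) : Fin m → R) = 0 := by
    refine hzero ((LinearEquiv.curry R Q (Fin m) ι).symm.toLinearMap ∘ₗ j.compLeft (Fin m))
      ((curry_inj (Fin m) ι).comp (hinj (Fin m)))
      (E.subtype - (LinearMap.ker p).subtype ∘ₗ r ∘ₗ s) fun x hx => ?_
    have h1 : s x = i ⟨x, hx⟩ := hinj n (by rw [hs]; exact hφ ⟨x, hx⟩)
    have h2 : r (s x) = ⟨x, hx⟩ := by rw [h1]; exact LinearMap.congr_fun hri _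
    change (x : Fin m → R) - (r (s x) : Fin m → R) = 0
    rw [h2, sub_self]
  rw [eq_bot_iff]
  intro y hy
  obtain ⟨x, rfl⟩ := hp y
  have h1 : x = r (s ⟨x, hy⟩) := sub_eq_zero.mp (hsplit ⟨x, hy⟩)
  rw [Submodule.mem_bot, h1]
  exact (r (s ⟨x, hy⟩)).2

/-- If `R` has dominant dimension at least `2` with respect to the projective-injective module `Q`,
and modules cogenerated by `Q` have projective dimension at most `1`, then the latter are the
torsion-free modules of a hereditary torsion pair, and no indecomposable injective module has
projective dimension `1`. -/
theorem hereditaryTorsionPair_of_dominantDimension [IsArtinianRing R]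
    [Module.Finite R Q] [Module.Injective R Q]
    [Module.Projective R Q] {ι κ : Type} [Finite ι] [Finite κ] (j : R →ₗ[R] (ι → Q))
    (hj : Function.Injective j) (g : (ι → Q) →ₗ[R] (κ → Q))
    (hjg : LinearMap.range j = LinearMap.ker g)
    (hpd : ∀ (X : Type u) [AddCommGroup X] [Module R X] [Module.Finite R X] {α : Type} [Finite α]
      (f : X →ₗ[R] (α → Q)), Function.Injective f → projectiveDimension (ModuleCat.of R X) ≤ 1) :
    (∃ 𝒯 ℱ : ObjectProperty (ModuleCat.{u} R),
        IsHereditaryTorsionPair R 𝒯 ℱ ∧ projDimLEOne R = ℱ) ∧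
      ∀ I : ModuleCat.{u} R, ModuleCat.isFG R I → Indecomposable I → Injective I →
        projectiveDimension I ≠ 1 := by
  have hfg : ∀ (X : ModuleCat.{u} R), ModuleCat.isFG R X → Module.Finite R X := fun _ h => h
  have hcog : ∀ X : ModuleCat.{u} R, projDimLEOne R X →
      ∃ (ι : Type) (_ : Finite ι) (f : X →ₗ[R] (ι → Q)), Function.Injective f := by
    rintro X ⟨hX, hX'⟩
    have := hfg X hX
    obtain ⟨K, hK, hK'⟩ := exists_torsion_submodule (R := R) Q X
    exact hK' (eq_bot_of_torsion_of_projectiveDimension_le_one Q j hj g hjg hX' K hK)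
  refine ⟨⟨fun M => ModuleCat.isFG R M ∧ ∀ f : M →ₗ[R] Q, f = 0, projDimLEOne R,
    ⟨⟨?_, ?_, ?_, ?_, ?_⟩, ⟨?_⟩⟩, rfl⟩, ?_⟩
  · exact fun M h => h.1
  · exact fun M h => h.1
  · rintro M N ⟨_, hM⟩ hN f
    obtain ⟨α, _, i, hi⟩ := hcog N hN
    exact ModuleCat.hom_ext (torsion_hom_pi_eq_zero Q hM i hi f.hom)
  · intro M hM h
    refine ⟨hM, fun f => ?_⟩
    have := h (ModuleCat.of R Q) ⟨‹Module.Finite R Q›, projectiveDimension_le_one_of_projective⟩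
      (ModuleCat.ofHom f)
    exact congrArg ModuleCat.Hom.hom this
  · intro N hN h
    have := hfg N hN
    obtain ⟨K, hK, hK'⟩ := exists_torsion_submodule (R := R) Q N
    have h0 := h (ModuleCat.of R K) ⟨inferInstanceAs (Module.Finite R K), hK⟩
      (ModuleCat.ofHom K.subtype)
    have h1 : K.subtype = 0 := congrArg ModuleCat.Hom.hom h0
    obtain ⟨α, _, i, hi⟩ := hK' (by rw [← Submodule.range_subtype K, h1, LinearMap.range_zero])
    exact ⟨hN, hpd N i hi⟩
  · rintro M' M f hf ⟨hM, hM'⟩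
    have := hfg M hM
    have hinj : Function.Injective f.hom := (ModuleCat.mono_iff_injective f).mp hf
    refine ⟨Module.Finite.of_injective f.hom hinj, fun a => ?_⟩
    obtain ⟨b, hb⟩ := Module.Injective.exists_extension f.hom hinj a
    refine LinearMap.ext fun x => ?_
    rw [← hb, hM' b, LinearMap.zero_apply, LinearMap.zero_apply]
  · intro I hI _ hinj h1
    obtain ⟨α, _, i, hi⟩ := hcog I ⟨hI, h1.le⟩
    have : Module.Injective R I := Module.injective_module_of_injective_object R I
    obtain ⟨r, hr⟩ := Module.Injective.exists_extension i hi (LinearMap.id : I →ₗ[R] I)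
    have : Module.Projective R I :=
      IsSummandOfPower.projective (Z := Q) ⟨α, inferInstance, i, r, LinearMap.ext hr⟩
    exact projectiveDimension_ne_one_of_projective h1

end DominantDimension

/-! ### From an additive generator to the torsion pair. -/

section AdditiveGenerator

variable {C R : Type u} [Ring C] [Ring R] {N : Type u} [AddCommGroup N] [Module C N]
  (ρ : R ≃+* (Module.End C N)ᵐᵒᵖ)

/-- The module `Hom_C(N, Y)` over the opposite `R` of the endomorphism ring of `N`. -/
abbrev EndHomModule (Y : Type*) [AddCommGroup Y] [Module C Y] : Type _ :=
  HomModule Y (ρ : R →+* (Module.End C N)ᵐᵒᵖ)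

/-- The module `R` is isomorphic to `Hom_C(N, N)`. -/
def homModuleSelfEquiv : R ≃ₗ[R] EndHomModule ρ N where
  toFun r := HomModule.of _ (ρ r).unop
  map_add' r s := by ext; simp
  map_smul' r s := by ext; simp
  invFun f := ρ.symm (MulOpposite.op f.hom)
  left_inv r := ρ.symm_apply_apply r
  right_inv f := by ext x; simp

variable {ρ}

theorem IsSummandOfPower.homModule {Z X : Type*} [AddCommGroup Z] [Module C Z] [AddCommGroup X]
    [Module C X] (h : IsSummandOfPower C Z X) :
    IsSummandOfPower R (EndHomModule ρ Z) (EndHomModule ρ X) := by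
  obtain ⟨ι, hι, s, r, hrs⟩ := h
  refine ⟨ι, hι, { toFun := fun f i => HomModule.of _ (LinearMap.proj i ∘ₗ s ∘ₗ f.hom)
                   map_add' := fun f g => by ext; simp
                   map_smul' := fun a f => by ext; simp },
    { toFun := fun f => HomModule.of _ (r ∘ₗ LinearMap.pi fun i => (f i).hom)
      map_add' := fun f g => by
        ext x
        simp only [HomModule.of_apply, LinearMap.comp_apply, HomModule.add_apply, ← map_add]
        rfl
      map_smul' := fun a f => rfl }, ?_⟩
  ext f x
  exact LinearMap.congr_fun hrs (f x)

theorem isSummandOfPower_homModule {X : Type*} [AddCommGroup X] [Module C X]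
    (h : IsSummandOfPower C N X) : IsSummandOfPower R R (EndHomModule ρ X) :=
  h.homModule.trans ((isSummandOfPower_power Unit).congr
    ((homModuleSelfEquiv ρ).symm.trans (LinearEquiv.funUnique Unit R R).symm))

/-- The map `N → Nᵐ` with components given by the action of the elements `rᵢ` of `R`. -/
def actionPi (ρ : R ≃+* (Module.End C N)ᵐᵒᵖ) {m : ℕ} (r : Fin m → R) : N →ₗ[C] (Fin m → N) :=
  LinearMap.pi fun i => (ρ (r i)).unop

theorem actionPi_apply {m : ℕ} (r : Fin m → R) (x : N) (i : Fin m) :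
    actionPi ρ r x i = (ρ (r i)).unop x := rfl

theorem exists_eq_actionPi {m : ℕ} (h : N →ₗ[C] (Fin m → N)) :
    ∃ r : Fin m → R, actionPi ρ r = h :=
  ⟨fun i => ρ.symm (MulOpposite.op (LinearMap.proj i ∘ₗ h)), by ext; simp [actionPi_apply]⟩

/-- A Yoneda statement: since R = Hom_C(N, N), maps R^m → Hom_C(N, Y) come from maps N^m → Y. -/
theorem exists_linearMap_actionPi {Y : Type*} [AddCommGroup Y] [Module C Y] {m : ℕ}
    (φ : (Fin m → R) →ₗ[R] EndHomModule ρ Y) :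
    ∃ G : (Fin m → N) →ₗ[C] Y, ∀ r x, G (actionPi ρ r x) = φ r x := by
  classical
  refine ⟨∑ i, (φ (Pi.single i 1)).hom ∘ₗ LinearMap.proj i, fun r x => ?_⟩
  have h1 : r = ∑ i, r i • (Pi.single i 1 : Fin m → R) := by
    ext i; simp [Pi.single_apply]
  conv_rhs => rw [h1, map_sum]
  simp [actionPi_apply]

/-- Baer's criterion. Generators of the ideal turn its inclusion and `φ` into `G : N^m → N` and `y :
N^m → Y`. If ker G ≤ ker y, then `y` factors through the image of `G` and extends to `z : N → Y`, an
element realising `φ`. -/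
theorem injective_homModule [IsNoetherianRing R] [IsNoetherianRing C] [Module.Finite C N]
    (hN : ∀ (X : Type u) [AddCommGroup X] [Module C X] [Module.Finite C X],
      IsSummandOfPower C N X)
    (Y : Type u) [AddCommGroup Y] [Module C Y] [Module.Injective C Y] :
    Module.Injective R (EndHomModule ρ Y) := by
  refine Module.Baer.injective fun I φ => ?_
  obtain ⟨m, p, hp⟩ := Module.Finite.exists_fin' R I
  obtain ⟨G, hG⟩ := exists_linearMap_actionPi
    ((homModuleSelfEquiv ρ).toLinearMap ∘ₗ I.subtype ∘ₗ p)
  obtain ⟨y, hy⟩ := exists_linearMap_actionPi (φ ∘ₗ p)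
  have hker : LinearMap.ker G ≤ LinearMap.ker y := by
    classical
    obtain ⟨ι, _, s, r, hrs⟩ := hN (LinearMap.ker G)
    have := Fintype.ofFinite ι
    -- Maps from `N` to ker G are relations among the generators, so `y` kills their images; these
    -- fill ker G because it lies in add N.
    have hzero : ∀ h : N →ₗ[C] LinearMap.ker G, ∀ n, y (h n) = 0 := by
      intro h n
      obtain ⟨a, ha⟩ := exists_eq_actionPi (ρ := ρ) ((LinearMap.ker G).subtype ∘ₗ h)
      have ha' : ∀ n, actionPi ρ a n = h n := LinearMap.congr_fun ha
      have h0 : p a = 0 := by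
        apply Subtype.ext
        apply (homModuleSelfEquiv ρ).injective
        ext n
        have := hG a n
        rw [ha', LinearMap.mem_ker.mp (h n).2] at this
        rw [ZeroMemClass.coe_zero, map_zero]
        exact this.symm
      rw [← ha', hy, LinearMap.comp_apply, h0, map_zero, HomModule.zero_apply]
    intro w hw
    have h1 : (⟨w, hw⟩ : LinearMap.ker G) = ∑ i, r (Pi.single i (s ⟨w, hw⟩ i)) := by
      rw [← map_sum, Finset.univ_sum_single]
      exact (LinearMap.congr_fun hrs _).symm
    have h2 : w = ∑ i, (r (Pi.single i (s ⟨w, hw⟩ i)) : Fin m → N) := by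
      simpa using congrArg (LinearMap.ker G).subtype h1
    rw [LinearMap.mem_ker, h2, map_sum]
    exact Finset.sum_eq_zero fun i _ => hzero (r ∘ₗ LinearMap.single C (fun _ => N) i) _
  obtain ⟨b, hb⟩ := LinearMap.exists_comp_eq_of_ker_le G.rangeRestrict G.surjective_rangeRestrict y
    (by rwa [LinearMap.ker_rangeRestrict])
  obtain ⟨z, hz⟩ := Module.Injective.exists_extension _ (Submodule.injective_subtype _) b
  refine ⟨LinearMap.toSpanSingleton R _ (HomModule.of (ρ : R →+* (Module.End C N)ᵐᵒᵖ) z),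
    fun x hx => ?_⟩
  obtain ⟨a, ha⟩ := hp ⟨x, hx⟩
  rw [← ha]
  ext n
  have h1 : G (actionPi ρ a n) = (ρ x).unop n := by
    rw [hG]
    simp only [LinearMap.comp_apply, ha]
    rfl
  have h2 : z (G (actionPi ρ a n)) = y (actionPi ρ a n) := by
    rw [← hb, ← hz]
    rfl
  rw [hy, h1] at h2
  exact h2

/-- The composite R^m → X → Hom_C(N, Y)^ι comes from a map N^m → Y^ι. By left exactness its kernel
is Hom_C(N, K) with K the kernel of that map, projective since K is in add N. -/
theorem projectiveDimension_le_one_of_homModule [IsNoetherianRing C]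
    [Module.Finite C N]
    (hN : ∀ (X : Type u) [AddCommGroup X] [Module C X] [Module.Finite C X],
      IsSummandOfPower C N X)
    {Y : Type u} [AddCommGroup Y] [Module C Y] {X : Type u} [AddCommGroup X] [Module R X]
    [Module.Finite R X] {ι : Type} (f : X →ₗ[R] (ι → EndHomModule ρ Y))
    (hf : Function.Injective f) : projectiveDimension (ModuleCat.of R X) ≤ 1 := by
  obtain ⟨m, p, hp⟩ := Module.Finite.exists_fin' R X
  rw [projectiveDimension_le_one_iff p hp]
  choose G hG using fun i => exists_linearMap_actionPi (LinearMap.proj i ∘ₗ f ∘ₗ p)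
  have hker : ∀ r : Fin m → R, r ∈ LinearMap.ker p ↔
      ∀ n, actionPi ρ r n ∈ LinearMap.ker (LinearMap.pi G) := by
    intro r
    rw [LinearMap.mem_ker, ← map_eq_zero_iff f hf]
    constructor
    · intro h n
      refine funext fun i => ?_
      rw [LinearMap.pi_apply, hG, LinearMap.comp_apply, LinearMap.comp_apply, h]
      rfl
    · intro h
      ext i n
      have := hG i r n
      rw [show G i (actionPi ρ r n) = 0 from congrFun (h n) i] at this
      exact this.symm
  let e : LinearMap.ker p →ₗ[R] EndHomModule ρ (LinearMap.ker (LinearMap.pi G)) :=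
    { toFun := fun r => HomModule.of _ ((actionPi ρ r).codRestrict _ ((hker r).mp r.2))
      map_add' := fun r s => by ext n i; simp [actionPi_apply]
      map_smul' := fun a r => by ext n i; simp [actionPi_apply] }
  have he : Function.Bijective e := by
    constructor
    · intro r s hrs
      apply Subtype.ext
      funext i
      apply (homModuleSelfEquiv ρ).injective
      ext n
      exact congrFun (congrArg Subtype.val (congrArg (fun h => h n) hrs)) i
    · intro h
      obtain ⟨r, hr⟩ := exists_eq_actionPi (ρ := ρ) (Submodule.subtype _ ∘ₗ h.hom)
      refine ⟨⟨r, (hker r).mpr fun n => ?_⟩, ?_⟩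
      · rw [hr]
        exact (h n).2
      · ext n : 1
        exact Subtype.ext (LinearMap.congr_fun hr n)
  exact ((isSummandOfPower_homModule (hN _)).congr (LinearEquiv.ofBijective e he)).projective

theorem hereditaryTorsionPair_of_additiveGenerator (k : Type v) [Field k] [Algebra k C]
    [Module.Finite k C] [IsArtinianRing R] [Module.Finite C N] (ρ : R ≃+* (Module.End C N)ᵐᵒᵖ)
    (hN : ∀ (X : Type u) [AddCommGroup X] [Module C X] [Module.Finite C X],
      IsSummandOfPower C N X) :
    (∃ 𝒯 ℱ : ObjectProperty (ModuleCat.{u} R),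
        IsHereditaryTorsionPair R 𝒯 ℱ ∧ projDimLEOne R = ℱ) ∧
      ∀ I : ModuleCat.{u} R, ModuleCat.isFG R I → Indecomposable I → Injective I →
        projectiveDimension I ≠ 1 := by
  have : IsNoetherianRing C := IsNoetherianRing.of_finite k C
  obtain ⟨Y, _, _, hYfin, hYinj, hY⟩ := exists_injective_cogenerator k C
  obtain ⟨ι, _, f, hf⟩ := hY N
  obtain ⟨κ, _, c, hc⟩ := hY ((ι → Y) ⧸ LinearMap.range f)
  have hsum : IsSummandOfPower R R (EndHomModule ρ Y) := isSummandOfPower_homModule (hN Y)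
  have hfin : Module.Finite R (EndHomModule ρ Y) := hsum.finite
  have hproj : Module.Projective R (EndHomModule ρ Y) := hsum.projective
  have hinj : Module.Injective R (EndHomModule ρ Y) := injective_homModule hN Y
  let j : R →ₗ[R] (ι → EndHomModule ρ Y) :=
    { toFun := fun r i => HomModule.of _ (LinearMap.proj i ∘ₗ f ∘ₗ (ρ r).unop)
      map_add' := fun r s => by ext; simp
      map_smul' := fun r s => by ext; simp }
  let g : (ι → EndHomModule ρ Y) →ₗ[R] (κ → EndHomModule ρ Y) :=
    { toFun := fun h a => HomModule.of _ (LinearMap.proj a ∘ₗ c ∘ₗ Submodule.mkQ _ ∘ₗ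
        LinearMap.pi fun i => (h i).hom)
      map_add' := fun h h' => by
        ext a n
        change c (Submodule.mkQ _ ((LinearMap.pi fun i => (h i).hom) n +
          (LinearMap.pi fun i => (h' i).hom) n)) a = _
        rw [map_add, map_add]
        rfl
      map_smul' := fun r h => rfl }
  refine hereditaryTorsionPair_of_dominantDimension (EndHomModule ρ Y) j ?_ g ?_
    fun X _ _ _ α _ i hi => projectiveDimension_le_one_of_homModule hN i hi
  · intro r s hrs
    apply (homModuleSelfEquiv ρ).injective
    ext n
    refine hf (funext fun i => ?_)
    exact congrArg (fun h => h i n) hrs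
  · ext h
    constructor
    · rintro ⟨r, rfl⟩
      ext a n
      change c (Submodule.mkQ _ (f ((ρ r).unop n))) a = 0
      rw [Submodule.mkQ_apply, (Submodule.Quotient.mk_eq_zero _).mpr (LinearMap.mem_range_self f _),
        map_zero]
      rfl
    · intro hh
      have h1 : ∀ n, (LinearMap.pi fun i => (h i).hom) n ∈ LinearMap.range f := by
        intro n
        rw [← Submodule.Quotient.mk_eq_zero, ← map_eq_zero_iff c hc]
        funext a
        exact congrArg (fun z => z a n) hh
      let h' : N →ₗ[C] N := (LinearEquiv.ofInjective f hf).symm.toLinearMap ∘ₗ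
        LinearMap.codRestrict _ (LinearMap.pi fun i => (h i).hom) h1
      have hh' : ∀ n, f (h' n) = fun i => h i n := fun n =>
        LinearEquiv.ofInjective_symm_apply (f := f) (h := hf) ⟨_, h1 n⟩
      refine ⟨ρ.symm (MulOpposite.op h'), ?_⟩
      ext i n
      change f ((ρ (ρ.symm (MulOpposite.op h'))).unop n) i = h i n
      rw [RingEquiv.apply_symm_apply, MulOpposite.unop_op, hh']

end AdditiveGenerator

/-! ### Injective submodules. -/

section Injective

variable {R : Type u} [Ring R]

theorem Module.Injective.of_retract {X Y : Type u} [AddCommGroup X] [Module R X] [AddCommGroup Y]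
    [Module R Y] [Module.Injective R Y] (s : X →ₗ[R] Y) (r : Y →ₗ[R] X)
    (hrs : r ∘ₗ s = LinearMap.id) : Module.Injective R X :=
  ⟨fun _ _ _ _ _ _ i hi f => by
    obtain ⟨g, hg⟩ := Module.Injective.exists_extension i hi (s ∘ₗ f)
    exact ⟨r ∘ₗ g, fun x => (congrArg r (hg x)).trans (LinearMap.congr_fun hrs (f x))⟩⟩

theorem Module.Injective.prod {X Y : Type u} [AddCommGroup X] [Module R X] [AddCommGroup Y]
    [Module R Y] [Module.Injective R X] [Module.Injective R Y] : Module.Injective R (X × Y) :=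
  ⟨fun _ _ _ _ _ _ i hi f => by
    obtain ⟨g, hg⟩ := Module.Injective.exists_extension i hi (LinearMap.fst R X Y ∘ₗ f)
    obtain ⟨h, hh⟩ := Module.Injective.exists_extension i hi (LinearMap.snd R X Y ∘ₗ f)
    exact ⟨g.prod h, fun x => Prod.ext (hg x) (hh x)⟩⟩

theorem Module.Projective.pi_of_finite {ι : Type*} [Finite ι] {Y : ι → Type*}
    [∀ i, AddCommGroup (Y i)] [∀ i, Module R (Y i)] [∀ i, Module.Projective R (Y i)] :
    Module.Projective R (∀ i, Y i) := by
  classical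
  have := Fintype.ofFinite ι
  exact Module.Projective.of_equiv (DFinsupp.linearEquivFunOnFintype (R := R) (M := Y))

/-- In an injective module `V` of finite length, a submodule `N` that meets a nonzero submodule
trivially is contained in a proper injective submodule. -/
theorem exists_injective_submodule_lt_top {V : Type u} [AddCommGroup V] [Module R V]
    [Module.Injective R V] [IsArtinian R V] [IsNoetherian R V] (N t : Submodule R V) (ht : t ≠ ⊥)
    (hd : Disjoint t N) : ∃ V' : Submodule R V, V' < ⊤ ∧ N ≤ V' ∧ Module.Injective R V' := by
  let i : (N × t) →ₗ[R] V := N.subtype.coprod t.subtype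
  have hi : Function.Injective i := by
    rw [injective_iff_map_eq_zero]
    rintro ⟨a, b⟩ hab
    have h1 : (a : V) = -b := eq_neg_of_add_eq_zero_left hab
    have h2 : (b : V) = 0 := Submodule.disjoint_def.mp hd b b.2 (by
      rw [← neg_neg (b : V), ← h1]; exact N.neg_mem a.2)
    exact Prod.ext (Subtype.ext (by rw [h1, h2]; simp)) (Subtype.ext h2)
  -- `θ` is the identity on `N` and zero on `t`. The range of a high positive power is a direct
  -- summand by Fitting, contains `N` and omits `t`.
  obtain ⟨θ, hθ⟩ := Module.Injective.exists_extension i hi (N.subtype ∘ₗ LinearMap.fst R N t)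
  have hN : ∀ a ∈ N, θ a = a := fun a ha => by simpa [i] using hθ (⟨a, ha⟩, 0)
  have ht0 : ∀ b ∈ t, θ b = 0 := fun b hb => by simpa [i] using hθ (0, ⟨b, hb⟩)
  obtain ⟨n, hn⟩ := Filter.eventually_atTop.mp
    (LinearMap.eventually_isCompl_ker_pow_range_pow (θ : Module.End R V))
  have hc := hn (n + 1) (by omega)
  set f : Module.End R V := (θ : Module.End R V) ^ (n + 1) with hf
  refine ⟨LinearMap.range f, lt_top_iff_ne_top.mpr fun htop => ht ?_, fun a ha => ⟨a, ?_⟩, ?_⟩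
  · rw [htop] at hc
    rw [eq_bot_iff, ← eq_bot_of_isCompl_top hc]
    intro b hb
    rw [LinearMap.mem_ker, hf, pow_succ, Module.End.mul_apply, ht0 b hb, map_zero]
  · have h1 : ∀ m : ℕ, ((θ : Module.End R V) ^ m) a = a := by
      intro m
      induction m with
      | zero => rfl
      | succ m ih => rw [pow_succ, Module.End.mul_apply, hN a ha, ih]
    exact h1 _
  · exact Module.Injective.of_retract (LinearMap.range f).subtype
      (Submodule.projectionOnto _ _ hc.symm) (Submodule.projectionOnto_comp_subtype hc.symm)

end Injective

/-! ### Consequences of P¹ being a hereditary torsion-free class. -/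

section TorsionFree

variable {R : Type u} [Ring R] {𝒯 : ObjectProperty (ModuleCat.{u} R)}

theorem IsTorsionPair.projDimLEOne_of_injective (h : IsTorsionPair R 𝒯 (projDimLEOne R))
    {X Y : Type u} [AddCommGroup X] [Module R X] [AddCommGroup Y] [Module R Y] [Module.Finite R X]
    (f : X →ₗ[R] Y) (hf : Function.Injective f) (hY : projDimLEOne R (ModuleCat.of R Y)) :
    projDimLEOne R (ModuleCat.of R X) := by
  refine h.torsionFree_of_hom_eq_zero _ ‹Module.Finite R X› fun M hM g => ?_
  have h0 := h.hom_eq_zero M _ hM hY (g ≫ ModuleCat.ofHom f)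
  ext x
  apply hf
  rw [ModuleCat.hom_zero, LinearMap.zero_apply, map_zero]
  exact LinearMap.congr_fun (congrArg ModuleCat.Hom.hom h0) x

theorem IsTorsionPair.projDimLEOne_pi (h : IsTorsionPair R 𝒯 (projDimLEOne R))
    {Y : Type u} [AddCommGroup Y] [Module R Y] (hY : projDimLEOne R (ModuleCat.of R Y))
    (ι : Type) [Finite ι] : projDimLEOne R (ModuleCat.of R (ι → Y)) := by
  have : Module.Finite R Y := hY.1
  refine h.torsionFree_of_hom_eq_zero _ (inferInstanceAs (Module.Finite R (ι → Y)))
    fun M hM g => ?_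
  ext x i
  have h0 := h.hom_eq_zero M _ hM hY (g ≫ ModuleCat.ofHom (LinearMap.proj i))
  exact LinearMap.congr_fun (congrArg ModuleCat.Hom.hom h0) x

/-- Take `t` to be the image of a nonzero map from a torsion module. By heredity `t ⊓ N` is torsion,
and it embeds in the torsion-free `N`, so it is zero. -/
theorem IsHereditaryTorsionPair.exists_disjoint_submodule
    [IsNoetherianRing R] (h : IsHereditaryTorsionPair R 𝒯 (projDimLEOne R))
    {V : Type u} [AddCommGroup V] [Module R V] [Module.Finite R V] (N : Submodule R V)
    (hN : projDimLEOne R (ModuleCat.of R N)) (hV : ¬ projDimLEOne R (ModuleCat.of R V)) :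
    ∃ t : Submodule R V, t ≠ ⊥ ∧ Disjoint t N := by
  have h1 : ∃ M, 𝒯 M ∧ ∃ f : M ⟶ ModuleCat.of R V, f ≠ 0 := by
    by_contra! hcon
    exact hV (h.torsionFree_of_hom_eq_zero _ ‹Module.Finite R V› hcon)
  obtain ⟨M, hM, f, hf⟩ := h1
  let t : Submodule R V := LinearMap.range f.hom
  have ht : 𝒯 (ModuleCat.of R t) := by
    refine h.torsion_of_hom_eq_zero _ (inferInstanceAs (Module.Finite R t)) fun F hF g => ?_
    have h0 := h.hom_eq_zero M F hM hF (ModuleCat.ofHom f.hom.rangeRestrict ≫ g)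
    ext y
    obtain ⟨x, hx⟩ := f.hom.surjective_rangeRestrict y
    rw [← hx]
    exact LinearMap.congr_fun (congrArg ModuleCat.Hom.hom h0) x
  refine ⟨t, fun h0 => hf ?_, ?_⟩
  · exact ModuleCat.hom_ext (LinearMap.range_eq_bot.mp h0)
  · have := h.closedUnderSubmodules
    have h1 : t ⊓ N ≤ t := inf_le_left
    have h2 : t ⊓ N ≤ N := inf_le_right
    have hmono : Mono (ModuleCat.ofHom (Submodule.inclusion h1)) :=
      (ModuleCat.mono_iff_injective _).mpr (Submodule.inclusion_injective h1)
    have htN : 𝒯 (ModuleCat.of R ↥(t ⊓ N)) :=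
      ObjectProperty.IsClosedUnderSubobjects.prop_of_mono
        (ModuleCat.ofHom (Submodule.inclusion h1)) ht
    have h0 := h.hom_eq_zero _ _ htN hN
      (ModuleCat.ofHom (Submodule.inclusion h2))
    rw [disjoint_iff, eq_bot_iff]
    intro x hx
    exact congrArg Subtype.val
      (LinearMap.congr_fun (congrArg ModuleCat.Hom.hom h0) (⟨x, hx⟩ : ↥(t ⊓ N)))

/-- Choose a minimal injective submodule containing `X` in a power of a cogenerator. Were it not in
P¹, it would contain a nonzero torsion submodule missing `X`, and a smaller injective would do. -/
theorem IsHereditaryTorsionPair.exists_injective_hull (k : Type v) [Field k] [Algebra k R]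
    [Module.Finite k R] (h : IsHereditaryTorsionPair R 𝒯 (projDimLEOne R))
    (X : Type u) [AddCommGroup X] [Module R X] (hX : projDimLEOne R (ModuleCat.of R X)) :
    ∃ (V : Type u) (_ : AddCommGroup V) (_ : Module R V), Module.Finite R V ∧
      Module.Injective R V ∧ projDimLEOne R (ModuleCat.of R V) ∧
      ∃ j : X →ₗ[R] V, Function.Injective j := by
  have : IsArtinianRing R := IsArtinianRing.of_finite k R
  have hXfin : Module.Finite R X := hX.1
  obtain ⟨W, _, _, hWfin, hWinj, hW⟩ := exists_injective_cogenerator k R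
  obtain ⟨ι, _, f, hf⟩ := hW X
  obtain ⟨V, ⟨hV1, hV2⟩, hmin⟩ := IsArtinian.set_has_minimal
    {V : Submodule R (ι → W) | LinearMap.range f ≤ V ∧ Module.Injective R V}
    ⟨⊤, le_top, Module.Injective.of_retract (Submodule.subtype ⊤)
      Submodule.topEquiv.symm.toLinearMap rfl⟩
  let j : X →ₗ[R] V := f.codRestrict V fun x => hV1 (LinearMap.mem_range_self f x)
  have hj : Function.Injective j := fun x y hxy => hf (congrArg Subtype.val hxy)
  refine ⟨V, inferInstance, inferInstance, inferInstance, hV2, ?_, j, hj⟩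
  by_contra hcon
  have hN : projDimLEOne R (ModuleCat.of R (LinearMap.range j)) :=
    h.projDimLEOne_of_injective (LinearEquiv.ofInjective j hj).symm.toLinearMap
      (LinearEquiv.injective _) hX
  obtain ⟨t, ht, hd⟩ := h.exists_disjoint_submodule _ hN hcon
  obtain ⟨V', hV', hle, hinj⟩ := exists_injective_submodule_lt_top _ t ht hd
  refine hmin (V'.map V.subtype) ⟨?_, ?_⟩
    (lt_of_le_of_ne (Submodule.map_subtype_le _ _) fun heq => ?_)
  · rintro _ ⟨x, rfl⟩
    exact ⟨j x, hle (LinearMap.mem_range_self j x), rfl⟩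
  · exact Module.Injective.of_retract (Y := V') (V.equivSubtypeMap V').symm.toLinearMap
      (V.equivSubtypeMap V').toLinearMap (by ext; simp)
  · refine hV'.ne (Submodule.map_injective_of_injective V.injective_subtype ?_)
    rw [heq, Submodule.map_subtype_top]

theorem IsTorsionPair.projective_of_injective [IsArtinianRing R]
    (h : IsTorsionPair R 𝒯 (projDimLEOne R))
    (hI : ∀ I : ModuleCat.{u} R, ModuleCat.isFG R I → Indecomposable I → Injective I →
      projectiveDimension I ≠ 1)
    (V : Type u) [AddCommGroup V] [Module R V] [Module.Finite R V] [Module.Injective R V]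
    (hV : projDimLEOne R (ModuleCat.of R V)) : Module.Projective R V := by
  obtain ⟨ι, _, Y, hY, ⟨e⟩⟩ := exists_pi_indecomposable (R := R) V
  have hproj : ∀ i, Module.Projective R (Y i) := by
    classical
    intro i
    have hinj : Module.Injective R (Y i) := Module.Injective.of_retract
      (e.symm.toLinearMap ∘ₗ LinearMap.single R (fun i => Y i) i)
      (LinearMap.proj i ∘ₗ e.toLinearMap) (by ext; simp)
    exact projective_of_projectiveDimension (X := ModuleCat.of R (Y i))
      (h.projDimLEOne_of_injective (Y i).subtype (Y i).injective_subtype hV).2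
      (hI (ModuleCat.of R (Y i)) (inferInstanceAs (Module.Finite R (Y i)))
        ((indecomposable_iff_isIndecomposableModule _).mpr (hY i))
        (Module.injective_object_of_injective_module R (Y i)))
  have := Module.Projective.pi_of_finite (R := R) (Y := fun i => Y i)
  exact Module.Projective.of_equiv e.symm

/-- Every finitely generated module over the endomorphism ring of `Q` has the form `Hom_R(P, Q)`
with `P` projective, hence is a summand of a power of `Q`. -/
theorem IsTorsionPair.isSummandOfPower_end [IsNoetherianRing R]
    (h : IsTorsionPair R 𝒯 (projDimLEOne R)) (Q : Type u) [AddCommGroup Q] [Module R Q]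
    [Module.Finite R Q] [Module.Injective R Q] [Module.Projective R Q]
    [IsNoetherianRing (Module.End R Q)] (X : Type u) [AddCommGroup X] [Module (Module.End R Q) X]
    [Module.Finite (Module.End R Q) X] : IsSummandOfPower (Module.End R Q) Q X := by
  classical
  obtain ⟨b, π, hπ⟩ := Module.Finite.exists_fin' (Module.End R Q) X
  obtain ⟨a, l, hl⟩ := Module.Finite.exists_fin' (Module.End R Q) (LinearMap.ker π)
  -- matrix of the presentation
  let m : Fin a → Fin b → Module.End R Q := fun j => l (Pi.single j 1)
  have hm : ∀ c : Fin a → Module.End R Q, (l c : Fin b → Module.End R Q) = ∑ j, c j • m j := by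
    intro c
    have h1 : c = ∑ j, c j • (Pi.single j 1 : Fin a → Module.End R Q) := by
      ext i; simp [Pi.single_apply]
    conv_lhs => rw [h1, map_sum]
    simp [m]
  let M : (Fin b → Q) →ₗ[R] (Fin a → Q) :=
    LinearMap.pi fun j => ∑ i, m j i ∘ₗ LinearMap.proj i
  have hM : ∀ x j, M x j = ∑ i, m j i (x i) := fun x j => by simp [M]
  have hQ : projDimLEOne R (ModuleCat.of R Q) :=
    ⟨‹Module.Finite R Q›, projectiveDimension_le_one_of_projective⟩
  have hQb : Module.Projective R (Fin b → Q) := Module.Projective.pi_of_finite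
  have hP : Module.Projective R (LinearMap.ker M) := by
    rw [← LinearMap.ker_rangeRestrict, ← projectiveDimension_le_one_iff M.rangeRestrict
      M.surjective_rangeRestrict]
    exact (h.projDimLEOne_of_injective _ (Submodule.injective_subtype _)
      (h.projDimLEOne_pi hQ (Fin a))).2
  let E : (Fin b → Module.End R Q) →ₗ[Module.End R Q] (LinearMap.ker M →ₗ[R] Q) :=
    { toFun := fun w => ∑ i, w i ∘ₗ LinearMap.proj i ∘ₗ (LinearMap.ker M).subtype
      map_add' := fun w w' => by ext; simp [Finset.sum_add_distrib]
      map_smul' := fun c w => by ext; simp }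
  have hE : ∀ w x, E w x = ∑ i, w i ((x : Fin b → Q) i) := fun w x => by simp [E]
  have hEs : Function.Surjective E := by
    intro f
    obtain ⟨g, hg⟩ := Module.Injective.exists_extension _ (Submodule.injective_subtype _) f
    refine ⟨fun i => g ∘ₗ LinearMap.single R (fun _ => Q) i, LinearMap.ext fun x => ?_⟩
    rw [hE, ← hg]
    simp only [LinearMap.comp_apply, LinearMap.coe_single, ← map_sum, Finset.univ_sum_single]
    rfl
  have hker : LinearMap.ker π = LinearMap.ker E := by
    ext w
    constructor
    · intro hw
      obtain ⟨c, hc⟩ := hl ⟨w, hw⟩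
      have hw' : w = ∑ j, c j • m j := by rw [← hm, hc]
      refine LinearMap.ext fun x => ?_
      have hx : ∀ j, ∑ i, m j i ((x : Fin b → Q) i) = 0 := fun j => by
        rw [← hM]; exact congrFun (LinearMap.mem_ker.mp x.2) j
      rw [hE, hw']
      simp only [Finset.sum_apply, Pi.smul_apply, LinearMap.sum_apply, smul_eq_mul,
        Module.End.mul_apply]
      rw [Finset.sum_comm]
      simp [← map_sum, hx]
    · intro hw
      let W : (Fin b → Q) →ₗ[R] Q := ∑ i, w i ∘ₗ LinearMap.proj i
      have hW : ∀ x, W x = ∑ i, w i (x i) := fun x => by simp [W]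
      -- A functional vanishing on ker M factors through im M; extended to Q^a by injectivity, it is
      -- a combination of the rows of the matrix.
      obtain ⟨g, hg⟩ := LinearMap.exists_comp_eq_of_ker_le M.rangeRestrict
        M.surjective_rangeRestrict W fun x hx => by
          rw [LinearMap.ker_rangeRestrict] at hx
          rw [LinearMap.mem_ker, hW]
          exact (hE w ⟨x, hx⟩).symm.trans (LinearMap.congr_fun hw _)
      obtain ⟨z, hz⟩ := Module.Injective.exists_extension _ (Submodule.injective_subtype _) g
      have hzM : ∀ x, z (M x) = W x := fun x => by rw [← hg, ← hz]; rfl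
      have hw' : w = l fun j => z ∘ₗ LinearMap.single R (fun _ => Q) j := by
        rw [hm]
        ext i q
        have h1 := hzM (Pi.single i q)
        rw [hW, Finset.sum_eq_single i (fun j _ hj => by simp [hj]) (by simp), Pi.single_eq_same]
          at h1
        rw [← h1, ← Finset.univ_sum_single (M (Pi.single i q)), map_sum]
        simp only [Finset.sum_apply, Pi.smul_apply, LinearMap.sum_apply, smul_eq_mul,
          Module.End.mul_apply, LinearMap.comp_apply, LinearMap.coe_single]
        refine Finset.sum_congr rfl fun j _ => ?_
        rw [hM, Finset.sum_eq_single i (fun j _ hj => by simp [hj]) (by simp), Pi.single_eq_same]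
      rw [hw']
      exact (l _).2
  let e : X ≃ₗ[Module.End R Q] (LinearMap.ker M →ₗ[R] Q) :=
    (π.quotKerEquivOfSurjective hπ).symm ≪≫ₗ Submodule.quotEquivOfEq _ _ hker ≪≫ₗ
      E.quotKerEquivOfSurjective hEs
  refine IsSummandOfPower.congr ?_ e
  obtain ⟨n, _, s, r, hrs⟩ := Module.Projective.isSummandOfPower (R := R) (X := LinearMap.ker M)
  have := Fintype.ofFinite n
  -- Apply Hom_R(-, Q) to the retraction of R^n onto ker M.
  refine ⟨n, inferInstance,
    { toFun := fun f i => f (r (Pi.single i 1))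
      map_add' := fun f g => rfl
      map_smul' := fun c f => rfl },
    { toFun := fun q => ∑ i, (LinearMap.toSpanSingleton R Q (q i)) ∘ₗ LinearMap.proj i ∘ₗ s
      map_add' := fun q q' => by ext; simp [Finset.sum_add_distrib]
      map_smul' := fun c q => by ext; simp }, ?_⟩
  ext f x
  have h1 : s x = ∑ i, s x i • (Pi.single i 1 : n → R) := by
    ext i; simp [Pi.single_apply]
  have h2 : x = ∑ i, s x i • r (Pi.single i 1) := by
    simp_rw [← map_smul, ← map_sum]
    rw [← h1]
    exact (LinearMap.congr_fun hrs x).symm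
  conv_rhs => rw [LinearMap.id_apply, h2, map_sum]
  simp

end TorsionFree

/-! ### The double centralizer property. -/

section DoubleCentralizer

variable {R Q : Type*} [Ring R] [AddCommGroup Q] [Module R Q]

/-- An endomorphism commuting with End_R(Q) is determined by its value at the cyclic vector `q₀`,
and that value is killed by every `b` killing `q₀`, so it lies in R q₀. -/
theorem bijective_toModuleEnd_of_cyclic_vector (q₀ : Q)
    (h1 : ∀ x, ∃ b : Module.End R Q, b q₀ = x)
    (h2 : ∀ x, (∀ b : Module.End R Q, b q₀ = 0 → b x = 0) → ∃ r : R, r • q₀ = x)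
    (h3 : ∀ r : R, r • q₀ = 0 → r = 0) :
    Function.Bijective (Module.toModuleEnd (Module.End R Q) (S := R) Q) := by
  constructor
  · rw [injective_iff_map_eq_zero]
    exact fun r hr => h3 r (LinearMap.congr_fun hr q₀)
  · intro ψ
    have hψ : ∀ (b : Module.End R Q) x, ψ (b x) = b (ψ x) := fun b x => map_smul ψ b x
    obtain ⟨r, hr⟩ := h2 (ψ q₀) fun b hb => by rw [← hψ, hb, map_zero]
    refine ⟨r, LinearMap.ext fun x => ?_⟩
    obtain ⟨b, rfl⟩ := h1 x
    rw [hψ, ← hr, map_smul]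
    rfl

end DoubleCentralizer

theorem exists_additive_generator (k : Type v) [Field k]
    (Λ : Type u) [Ring Λ] [Algebra k Λ] [Module.Finite k Λ]
    {𝒯 : ObjectProperty (ModuleCat.{u} Λᵐᵒᵖ)}
    (h : IsHereditaryTorsionPair Λᵐᵒᵖ 𝒯 (projDimLEOne Λᵐᵒᵖ))
    (hI : ∀ I : ModuleCat.{u} Λᵐᵒᵖ, ModuleCat.isFG Λᵐᵒᵖ I → Indecomposable I → Injective I →
        projectiveDimension I ≠ 1) :
    ∃ (A : Type u) (_ : Ring A) (_ : Algebra k A), Module.Finite k A ∧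
      ∃ (N : Type u) (_ : AddCommGroup N) (_ : Module Aᵐᵒᵖ N), Module.Finite Aᵐᵒᵖ N ∧
        (∀ (X : Type u) [AddCommGroup X] [Module Aᵐᵒᵖ X] [Module.Finite Aᵐᵒᵖ X],
          IsSummandOfPower Aᵐᵒᵖ N X) ∧
        ∃ e : Λ ≃+* Module.End Aᵐᵒᵖ N, ∀ (c : k) (n : N),
          e (algebraMap k Λ c) n = algebraMap k Aᵐᵒᵖ c • n := by
  have : IsArtinianRing Λᵐᵒᵖ := IsArtinianRing.of_finite k Λᵐᵒᵖ
  obtain ⟨V₀, _, _, _, _, hV₀, j, hj⟩ := h.exists_injective_hull k Λᵐᵒᵖ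
    ⟨inferInstanceAs (Module.Finite Λᵐᵒᵖ Λᵐᵒᵖ), projectiveDimension_le_one_of_projective⟩
  have hP₀ := h.projective_of_injective hI V₀ hV₀
  -- The sequence 0 → R → V₀ → V₀/R → 0 is a projective resolution of length 1.
  have hC : projDimLEOne Λᵐᵒᵖ (ModuleCat.of Λᵐᵒᵖ (V₀ ⧸ LinearMap.range j)) := by
    refine ⟨inferInstanceAs (Module.Finite Λᵐᵒᵖ (V₀ ⧸ LinearMap.range j)), ?_⟩
    rw [projectiveDimension_le_one_iff _ (Submodule.mkQ_surjective _), Submodule.ker_mkQ]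
    exact Module.Projective.of_equiv (LinearEquiv.ofInjective j hj)
  obtain ⟨V₁, _, _, _, _, hV₁, i, hi⟩ := h.exists_injective_hull k _ hC
  have hP₁ := h.projective_of_injective hI V₁ hV₁
  have hinj : Module.Injective Λᵐᵒᵖ (V₀ × V₁) := Module.Injective.prod
  let B := Module.End Λᵐᵒᵖ (V₀ × V₁)
  let : Module k (V₀ × V₁) := Module.restrictScalars k Λᵐᵒᵖ (V₀ × V₁)
  have : IsScalarTower k Λᵐᵒᵖ (V₀ × V₁) := IsScalarTower.restrictScalars k Λᵐᵒᵖ (V₀ × V₁)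
  have : Module.Finite k (V₀ × V₁) := Module.Finite.trans Λᵐᵒᵖ (V₀ × V₁)
  have hBfin : Module.Finite k B := by
    let F : B →ₗ[k] Module.End k (V₀ × V₁) :=
      { toFun := fun b => b.restrictScalars k
        map_add' := fun _ _ => rfl
        map_smul' := fun _ _ => rfl }
    exact Module.Finite.of_injective F (LinearMap.restrictScalars_injective k)
  have hBart : IsArtinianRing B := IsArtinianRing.of_finite k B
  have hQB : Module.Finite B (V₀ × V₁) := by
    have : IsScalarTower k B (V₀ × V₁) := ⟨fun c b x => rfl⟩
    exact Module.Finite.of_restrictScalars_finite k B (V₀ × V₁)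
  obtain ⟨N, _, _, hNfin, hN, e, he⟩ := exists_dual_additive_generator k B (V₀ × V₁)
    fun X _ _ _ => h.isSummandOfPower_end (V₀ × V₁) X
  -- The vector is the image of 1. Projection to `V₁` and the map through V₀/R → V₁ both kill it and
  -- together cut out exactly R · (j 1, 0).
  have hbij := bijective_toModuleEnd_of_cyclic_vector (R := Λᵐᵒᵖ) ((j 1, 0) : V₀ × V₁) ?_ ?_ ?_
  · let e' : Λᵐᵒᵖ ≃+* Module.End B (V₀ × V₁) := RingEquiv.ofBijective _ hbij
    refine ⟨B, inferInstance, inferInstance, hBfin, N, inferInstance, inferInstance, hNfin, hN,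
      (RingEquiv.opOp Λ).trans ((RingEquiv.op e').trans e), fun c n => ?_⟩
    exact he c _ (fun q => IsScalarTower.algebraMap_smul Λᵐᵒᵖ c q) n
  · intro x
    obtain ⟨g, hg⟩ := Module.Injective.exists_extension j hj
      (LinearMap.toSpanSingleton Λᵐᵒᵖ (V₀ × V₁) x)
    exact ⟨g ∘ₗ LinearMap.fst _ _ _, by simpa using hg 1⟩
  · rintro ⟨x₀, x₁⟩ hx
    have hx₁ : x₁ = 0 := by
      simpa using hx (LinearMap.inr _ _ _ ∘ₗ LinearMap.snd _ _ _) (by simp)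
    have hx₀ := hx (LinearMap.inr _ _ _ ∘ₗ i ∘ₗ Submodule.mkQ _ ∘ₗ LinearMap.fst _ _ _)
      (by simp [(Submodule.Quotient.mk_eq_zero _).mpr (LinearMap.mem_range_self j 1)])
    have h1 : i (Submodule.mkQ _ x₀) = 0 := congrArg Prod.snd hx₀
    rw [map_eq_zero_iff i hi, Submodule.mkQ_apply, Submodule.Quotient.mk_eq_zero] at h1
    obtain ⟨r, rfl⟩ := h1
    exact ⟨r, by rw [hx₁, Prod.smul_mk, ← map_smul, smul_eq_mul, mul_one, smul_zero]⟩
  · intro r hr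
    have h1 : r • j 1 = 0 := congrArg Prod.fst hr
    rw [← map_smul, smul_eq_mul, mul_one] at h1
    exact hj (by rw [h1, map_zero])

/-! ### Additive generators and complete sets of indecomposables. -/

section Grouping

variable {C : Type u} [Ring C]

theorem exists_equiv_pi_powers {ι : Type} [Finite ι] (Y : ι → ModuleCat.{u} C) :
    ∃ (n : ℕ) (M : Fin n → ModuleCat.{u} C) (m : Fin n → ℕ),
      (∀ q, ∃ i, M q = Y i) ∧ (∀ i, ∃ q, Nonempty (Y i ≅ M q)) ∧
      (∀ q q', Nonempty (M q ≅ M q') → q = q') ∧ (∀ q, 1 ≤ m q) ∧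
      Nonempty ((∀ i, Y i) ≃ₗ[C] ∀ q, Fin (m q) → M q) := by
  classical
  let S : Setoid ι :=
    { r := fun i j => Nonempty (Y i ≅ Y j)
      iseqv := ⟨fun _ => ⟨Iso.refl _⟩, fun ⟨f⟩ => ⟨f.symm⟩, fun ⟨f⟩ ⟨g⟩ => ⟨f ≪≫ g⟩⟩ }
  let φ := Finite.equivFin (Quotient S)
  let cls : ι → Fin (Nat.card (Quotient S)) := fun i => φ (Quotient.mk S i)
  let rep : Fin (Nat.card (Quotient S)) → ι := fun q => (φ.symm q).out
  have hrep : ∀ q, cls (rep q) = q := fun q => by simp [cls, rep]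
  have hcls : ∀ i j, cls i = cls j ↔ Nonempty (Y i ≅ Y j) := fun i j =>
    φ.injective.eq_iff.trans Quotient.eq
  have hfib : ∀ q, ∀ x : {i // cls i = q}, Nonempty (Y x.1 ≃ₗ[C] Y (rep q)) := fun q x => by
    obtain ⟨f⟩ := (hcls x.1 (rep q)).mp (x.2.trans (hrep q).symm)
    exact ⟨f.toLinearEquiv⟩
  refine ⟨_, fun q => Y (rep q), fun q => Nat.card {i // cls i = q}, fun q => ⟨_, rfl⟩,
    fun i => ⟨cls i, (hcls _ _).mp (hrep _).symm⟩, fun q q' hq => ?_, fun q => ?_, ⟨?_⟩⟩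
  · rw [← hrep q, ← hrep q']
    exact (hcls _ _).mpr hq
  · have : Nonempty {i // cls i = q} := ⟨⟨rep q, hrep q⟩⟩
    exact Nat.card_pos
  · let e : (∀ i, Y i) ≃ₗ[C] ∀ q, ∀ x : {i // cls i = q}, Y x.1 :=
      { toFun := fun y _ x => y x.1
        map_add' := fun _ _ => rfl
        map_smul' := fun _ _ => rfl
        invFun := fun z i => z (cls i) ⟨i, rfl⟩
        left_inv := fun _ => rfl
        right_inv := fun z => by
          ext q ⟨i, hi⟩
          subst hi
          rfl }
    exact e ≪≫ₗ LinearEquiv.piCongrRight fun q =>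
      (LinearEquiv.piCongrRight fun x => (hfib q x).some) ≪≫ₗ
        LinearEquiv.funCongrLeft C (Y (rep q)) (Finite.equivFin _).symm

/-- Every indecomposable is a retract of a power of `N`, hence by Krull–Schmidt isomorphic to one of
the indecomposable factors of `N`. -/
theorem exists_completeSetOfIndecomposables [IsArtinianRing C] (N : Type u) [AddCommGroup N]
    [Module C N] [Module.Finite C N]
    (hN : ∀ (X : Type u) [AddCommGroup X] [Module C X] [Module.Finite C X],
      IsSummandOfPower C N X) :
    ∃ (n : ℕ) (M : Fin n → ModuleCat.{u} C) (m : Fin n → ℕ),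
      IsCompleteSetOfIndecomposables C M ∧ (∀ i, 1 ≤ m i) ∧
      Nonempty (N ≃ₗ[C] ∀ i, Fin (m i) → M i) := by
  obtain ⟨ι, _, Y, hY, ⟨e⟩⟩ := exists_pi_indecomposable (R := C) N
  obtain ⟨n, M, m, hMY, hYM, hMM, hm, ⟨f⟩⟩ := exists_equiv_pi_powers fun i => ModuleCat.of C (Y i)
  refine ⟨n, M, m, ⟨fun q => ?_, fun q => ?_, hMM, fun X hX hX' => ?_⟩, hm, ⟨e ≪≫ₗ f⟩⟩
  · obtain ⟨i, hi⟩ := hMY q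
    rw [hi]
    exact inferInstanceAs (Module.Finite C (Y i))
  · obtain ⟨i, hi⟩ := hMY q
    rw [hi, indecomposable_iff_isIndecomposableModule]
    exact hY i
  · have : Module.Finite C X := hX
    obtain ⟨κ, _, s, r, hrs⟩ := hN X
    let s' : X →ₗ[C] ∀ p : κ × ι, Y p.2 :=
      LinearMap.pi fun p => LinearMap.proj p.2 ∘ₗ e.toLinearMap ∘ₗ LinearMap.proj p.1 ∘ₗ s
    let r' : (∀ p : κ × ι, Y p.2) →ₗ[C] X :=
      r ∘ₗ LinearMap.pi fun a => e.symm.toLinearMap ∘ₗ LinearMap.pi fun i =>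
        LinearMap.proj (a, i)
    have hrs' : r' ∘ₗ s' = LinearMap.id := by
      refine LinearMap.ext fun x => ?_
      have h1 : (fun a => e.symm fun i => e (s x a) i) = s x :=
        funext fun a => e.symm_apply_apply _
      exact (congrArg r h1).trans (LinearMap.congr_fun hrs x)
    obtain ⟨p, ⟨g⟩⟩ := ((indecomposable_iff_isIndecomposableModule X).mp
      hX').exists_equiv_of_retract_pi (fun p : κ × ι => hY p.2) s' r' hrs'
    obtain ⟨q, ⟨g'⟩⟩ := hYM p.2
    exact ⟨q, ⟨g.toModuleIso ≪≫ g'⟩⟩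

theorem IsCompleteSetOfIndecomposables.isSummandOfPower [IsArtinianRing C] {n : ℕ}
    {M : Fin n → ModuleCat.{u} C} (hM : IsCompleteSetOfIndecomposables C M) {m : Fin n → ℕ}
    (hm : ∀ i, 1 ≤ m i) (X : Type u) [AddCommGroup X] [Module C X] [Module.Finite C X] :
    IsSummandOfPower C (∀ i, Fin (m i) → M i) X := by
  classical
  obtain ⟨ι, _, Y, hY, ⟨e⟩⟩ := exists_pi_indecomposable (R := C) X
  refine (isSummandOfPower_pi fun i => ?_).congr e
  obtain ⟨q, ⟨f⟩⟩ := hM.exists_iso (ModuleCat.of C (Y i)) (inferInstanceAs (Module.Finite C (Y i)))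
    ((indecomposable_iff_isIndecomposableModule _).mpr (hY i))
  refine IsSummandOfPower.congr (Y := M q) ?_ f.toLinearEquiv
  let t : Fin (m q) := ⟨0, hm q⟩
  refine ((isSummandOfPower_power Unit).congr (LinearEquiv.funUnique Unit C _).symm).of_retract
    (LinearMap.single C (fun i => Fin (m i) → M i) q ∘ₗ LinearMap.single C (fun _ => M q) t)
    (LinearMap.proj t ∘ₗ LinearMap.proj q) ?_
  ext x
  simp

end Grouping

/-! ### The main theorem. -/

theorem mainTheorem1 (k : Type v) [Field k] [IsAlgClosed k]
    (Λ : Type u) [Ring Λ] [Algebra k Λ] [Module.Finite k Λ] :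
    IsAuslanderAlgebra k Λ ↔
      (∃ 𝒯 ℱ : ObjectProperty (ModuleCat.{u} Λᵐᵒᵖ),
        IsHereditaryTorsionPair Λᵐᵒᵖ 𝒯 ℱ ∧ projDimLEOne Λᵐᵒᵖ = ℱ) ∧
      ∀ I : ModuleCat.{u} Λᵐᵒᵖ, ModuleCat.isFG Λᵐᵒᵖ I → Indecomposable I → Injective I →
        projectiveDimension I ≠ 1 := by
  constructor
  · rintro ⟨A, _, _, _, n, M, m, hM, hm, ⟨e⟩⟩
    have : IsArtinianRing Aᵐᵒᵖ := IsArtinianRing.of_finite k Aᵐᵒᵖ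
    have : IsArtinianRing Λᵐᵒᵖ := IsArtinianRing.of_finite k Λᵐᵒᵖ
    have : ∀ i, Module.Finite Aᵐᵒᵖ (M i) := hM.finite
    exact hereditaryTorsionPair_of_additiveGenerator k
      (RingEquiv.op (e.toRingEquiv.trans (ModuleCat.endRingEquiv _)))
      fun X _ _ _ => hM.isSummandOfPower hm X
  · rintro ⟨⟨𝒯, _, h, rfl⟩, hI⟩
    obtain ⟨A, _, _, hA, N, _, _, _, hN, e, he⟩ := exists_additive_generator k Λ h hI
    have : IsArtinianRing Aᵐᵒᵖ := IsArtinianRing.of_finite k Aᵐᵒᵖ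
    obtain ⟨n, M, m, hM, hm, ⟨f⟩⟩ := exists_completeSetOfIndecomposables N hN
    refine ⟨A, inferInstance, inferInstance, hA, n, M, m, hM, hm,
      ⟨AlgEquiv.ofRingEquiv (f := (e.trans f.conjRingEquiv).trans
        (ModuleCat.endRingEquiv (ModuleCat.of Aᵐᵒᵖ (∀ i, Fin (m i) → M i))).symm) fun c => ?_⟩⟩
    -- The ring isomorphism is `k`-linear because `e` sends scalars to scalar multiplications, which
    -- conjugation by `f` preserves.
    refine ModuleCat.hom_ext (LinearMap.ext fun x => ?_)
    change f (e (algebraMap k Λ c) (f.symm x)) = algebraMap k Aᵐᵒᵖ c • x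
    rw [he, map_smul, LinearEquiv.apply_symm_apply]
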